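/- **The calculus $\lambda_H$.** Fix base types $B$ (including $\mathsf{Bool}$), constants $k$ with a base type $\mathsf{ty}(k)$ (the constants of type $\mathsf{Bool}$ being exactly the two distinct constants $\mathsf{true},\mathsf{false}$), operation symbols with arities, and blame labels; $l$ ranges over the proper labels and the empty label $\bullet$. The syntax is $$T ::= \{x{:}B\mid e\}\mid T_1\to T_2,\qquad a::=\bullet\mid c,\qquad c::=r\mid c_1\mapsto c_2,\qquad r::=\mathsf{nil}\mid \{x{:}B\mid e\}^l,r,$$ $$e::=x\mid k\mid \lambda x{:}T.\,e\mid e_1\,e_2\mid op(e_1,\dots,e_n)\mid \langle T_1\overset{a}{\Rightarrow}T_2\rangle^l\,e\mid \Uparrow l\mid\langle\{x{:}B\mid e_1\},e_2,k\rangle^l\mid\langle\{x{:}B\mid e_1\},s,r,k,e_2\rangle ,$$ where the status $s$ is $\checkmark$ or $?$. Types are closed ($x$ is the only free variable of $e$ in $\{x{:}B\mid e\}$), and the terms in active checks $\langle\{x{:}B\mid e_1\},e_2,k\rangle^l$ and coercion stacks are closed. Also given are a relation $\{x{:}B\mid e_1\}\supset\{x{:}B\mid e_2\}$ between refinements of the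 same base type; for each operation a first-order type $\{x{:}B_1\mid e_1\}\to\cdots\to\{x{:}B_n\mid e_n\}\to\{x{:}B\mid e\}$; and for each operation a partial function $[\![op]\!]$ on constants. **Coercions.** $\mathsf{coerce}(\{x{:}B\mid e_1\},\{x{:}B\mid e_2\},l)=\{x{:}B\mid e_2\}^l,\mathsf{nil}$ and $\mathsf{coerce}(T_{11}\to T_{12},T_{21}\to T_{22},l)=\mathsf{coerce}(T_{21},T_{11},l)\mapsto\mathsf{coerce}(T_{12},T_{22},l)$. Merging is $\mathsf{nil}\rhd r_2=r_2$, $(\{x{:}B\mid e\}^l,r_1)\rhd r_2=\{x{:}B\mid e\}^l,\bigl((r_1\rhd r_2)\setminus\{x{:}B\mid e\}\bigr)$, and $(c_{11}\mapsto c_{12})\rhd(c_{21}\mapsto c_{22})=(c_{21}\rhd c_{11})\mapsto(c_{12}\rhd c_{22})$, where $r\setminus T$ deletes from $r$ every type $T'$ with $T\supset T'$. These functions are undefined in the remaining cases. **Reduction.** There are two semantics: classic ($\mathsf C$) and eidetic ($\mathsf E$). Constants and closed abstractions are values in both; in $\mathsf C$ so is $\langle T_{11}\to T_{12}\overset{\bullet}{\Rightarrow}T_{21}\to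 T_{22}\rangle^l v$ for a value $v$; in $\mathsf E$ so is $\langle T_{11}\to T_{12}\overset{c_1\mapsto c_2}{\Rightarrow}T_{21}\to T_{22}\rangle^\bullet(\lambda x{:}T.\,e)$. One-step reduction $\longrightarrow_m$ of closed terms, for $m\in\{\mathsf C,\mathsf E\}$, is left-to-right call-by-value. * In both modes: $(\lambda x{:}T.\,e)\,v\longrightarrow e[v/x]$; $op(k_1,\dots,k_n)\longrightarrow[\![op]\!](k_1,\dots,k_n)$ when defined; for a function proxy that is a value, $\langle T_{11}\to T_{12}\overset{a}{\Rightarrow}T_{21}\to T_{22}\rangle^l e\;\,v\longrightarrow\langle T_{12}\overset{a_2}{\Rightarrow}T_{22}\rangle^l\bigl(e\,(\langle T_{21}\overset{a_1}{\Rightarrow}T_{11}\rangle^l v)\bigr)$, with $a_1=a_2=\bullet$ if $a=\bullet$ and $a_i=c_i$ if $a=c_1\mapsto c_2$; an active check with $e_2=\mathsf{true}$ steps to $k$ and with $e_2=\mathsf{false}$ to $\Uparrow l$. Evaluation proceeds under applications, operations and active checks, and $\Uparrow l$ in evaluation position there aborts to $\Uparrow l$. * In $\mathsf C$: $\langle\{x{:}B\mid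 e_1\}\overset{\bullet}{\Rightarrow}\{x{:}B\mid e_2\}\rangle^l k\longrightarrow\langle\{x{:}B\mid e_2\},e_2[k/x],k\rangle^l$; evaluation proceeds under, and blame propagates through, casts annotated with $\bullet$. * In $\mathsf E$: $\langle T_1\overset{\bullet}{\Rightarrow}T_2\rangle^l e\longrightarrow\langle T_1\overset{c}{\Rightarrow}T_2\rangle^\bullet e$ with $c=\mathsf{coerce}(T_1,T_2,l)$; $\langle T_2\overset{c_2}{\Rightarrow}T_3\rangle^{l}\langle T_1\overset{c_1}{\Rightarrow}T_2\rangle^{l'}e\longrightarrow\langle T_1\overset{c_1\rhd c_2}{\Longrightarrow}T_3\rangle^{l}e$; $\langle\{x{:}B\mid e_1\}\overset{r}{\Rightarrow}\{x{:}B\mid e_2\}\rangle^{l} k\longrightarrow\langle\{x{:}B\mid e_2\},?,r,k,k\rangle$; $\langle T,s,(\{x{:}B\mid e'\}^l,r),k,k\rangle\longrightarrow\langle T,s',r,k,\langle\{x{:}B\mid e'\},e'[k/x],k\rangle^l\rangle$, where $T$ has base type $B$, and $s'=\checkmark$ if $s=\checkmark$ or $\{x{:}B\mid e'\}$ equals or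 implies ($\supset$) $T$, and $s'={?}$ otherwise; $\langle T,\checkmark,\mathsf{nil},k,k\rangle\longrightarrow k$. Evaluation proceeds under stacks and, when the inner term is not itself a coercion-annotated cast, under coercion-annotated casts; blame propagates through both. **Typing.** $\vdash_m\{x{:}B\mid\mathsf{true}\}$ always; $\vdash_m\{x{:}B\mid e\}$ if $x{:}\{x{:}B\mid\mathsf{true}\}\vdash_m e:\{x{:}\mathsf{Bool}\mid\mathsf{true}\}$; $\vdash_m T_1\to T_2$ if $\vdash_m T_1$ and $\vdash_m T_2$. Types are compatible when they have the same arrow structure and base types. Terms are typed by the usual simply typed rules for variables (in well-formed contexts), abstractions, applications and operations. A constant $k$ has each well-formed type $\{x{:}B\mid e\}$ with $\mathsf{ty}(k)=B$ and $e[k/x]\longrightarrow_m^*\mathsf{true}$. A cast $\langle T_1\overset{\bullet}{\Rightarrow}T_2\rangle^l e$ has type $T_2$ if $e:T_1$ and $T_1,T_2$ are well formed and compatible. In $\mathsf E$, $\langle T_1\overset{c}{\Rightarrow}T_2\rangle^\bullet e$ has type $T_2$ if $e:T_1$ and $c$ is a well-formed coercion from $T_1$ to $T_2$: a function coercion $c_1\mapsto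 c_2$ from $T_{11}\to T_{12}$ to $T_{21}\to T_{22}$ consists of well-formed coercions $c_1$ from $T_{21}$ to $T_{11}$ and $c_2$ from $T_{12}$ to $T_{22}$; a refinement list is well formed between well-formed refinements of $B$ if its types are well-formed refinements of $B$, pairwise distinct, and at least one of them implies the target. The run-time forms are typed (at well-formed types, in well-formed contexts) as follows. * $\Uparrow l$ has every well-formed type. * $\langle\{x{:}B\mid e_1\},e_2,k\rangle^l$ has type $\{x{:}B\mid e_1\}$ if $\mathsf{ty}(k)=B$, $\emptyset\vdash_m e_2:\{x{:}\mathsf{Bool}\mid\mathsf{true}\}$ and $e_1[k/x]\longrightarrow^*_m e_2$. * In $\mathsf E$, $\langle\{x{:}B\mid e_1\},s,r,k,e_2\rangle$ has type $\{x{:}B\mid e_1\}$ if $\mathsf{ty}(k)=B$; the types in $r$ are pairwise distinct well-formed refinements of $B$; $e_2$ is $k$, an active check of $k$, or blame, and is typed at a refinement of $B$; if $s={?}$, some type in $r$ implies $\{x{:}B\mid e_1\}$; and if $s=\checkmark$, either $e_1[k/x]\longrightarrow_{\mathsf E}^*\mathsf{true}$ or $\langle\{x{:}B\mid e\},e[k/x],k\rangle^{l}\longrightarrow_{\mathsf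 E}^*e_2$ for some $l$ and some $\{x{:}B\mid e\}\supset\{x{:}B\mid e_1\}$. A judgment holds *as a source program (source type)* if it has a derivation in which, also inside types, every constant gets only the type $\{x{:}B\mid\mathsf{true}\}$, every cast has annotation $\bullet$ and a proper label, and no run-time form (blame, active check, stack) is typed. **Standing assumptions.** In both modes $m$: the argument and result types of operations are well formed; for constants $k_i$ with $\mathsf{ty}(k_i)=B_i$, $[\![op]\!](k_1,\dots,k_n)$ is defined if and only if $e_i[k_i/x]\longrightarrow^*_m\mathsf{true}$ for all $i$; and then its value $k$ has $\mathsf{ty}(k)=B$ and $e[k/x]\longrightarrow^*_m\mathsf{true}$. The relation $\supset$ is reflexive on well-formed eidetic types, transitive, and adequate: if $\{x{:}B\mid e_1\}\supset\{x{:}B\mid e_2\}$, $\mathsf{ty}(k)=B$ and $e_1[k/x]\longrightarrow^*_{\mathsf E}\mathsf{true}$, then $e_2[k/x]\longrightarrow^*_{\mathsf E}\mathsf{true}$. **The blame-exact logical relation** between closed classic (left) and eidetic (right) terms, by recursion on the type. * Values: $v_1\sim_{\mathsf E}v_2:\{x{:}B\mid e\}$ iff $v_1=v_2=k$ for a constant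 $k$ with $\mathsf{ty}(k)=B$ and $e[k/x]\longrightarrow_{\mathsf E}^*\mathsf{true}$. And $v_1\sim_{\mathsf E}v_2:T_1\to T_2$ iff $v_1$ is a classic value, $v_2$ is an eidetic value, $\emptyset\vdash_{\mathsf E}v_2:T_1\to T_2$, and $v_1\,u_1\simeq_{\mathsf E}v_2\,u_2:T_2$ whenever $u_1\sim_{\mathsf E}u_2:T_1$. * Terms: $e_1\simeq_{\mathsf E}e_2:T$ iff either there is an $l$ with $e_1\longrightarrow_{\mathsf C}^*\Uparrow l$ and $e_2\longrightarrow_{\mathsf E}^*\Uparrow l$, or there are values $v_1,v_2$ with $e_1\longrightarrow_{\mathsf C}^*v_1$, $e_2\longrightarrow_{\mathsf E}^*v_2$ and $v_1\sim_{\mathsf E}v_2:T$. * Types: $\{x{:}B\mid e_1\}\sim_{\mathsf E}\{x{:}B\mid e_2\}$ iff $e_1[v_1/x]\simeq_{\mathsf E}e_2[v_2/x]:\{x{:}\mathsf{Bool}\mid\mathsf{true}\}$ whenever $v_1\sim_{\mathsf E}v_2:\{x{:}B\mid\mathsf{true}\}$; $T_{11}\to T_{12}\sim_{\mathsf E}T_{21}\to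 T_{22}$ iff $T_{11}\sim_{\mathsf E}T_{21}$ and $T_{12}\sim_{\mathsf E}T_{22}$. * Open terms: $\Gamma\vdash e_1\simeq_{\mathsf E}e_2:T$ iff $\delta_1(e_1)\simeq_{\mathsf E}\delta_2(e_2):T$ for all substitutions $\delta_1,\delta_2$ of closed terms with $\delta_1(x)\sim_{\mathsf E}\delta_2(x):\Gamma(x)$ for every $x$ in the domain of $\Gamma$. **Lemma (Relating classic and eidetic source programs).** 1. If $\Gamma\vdash_{\mathsf C}e:T$ as a source program, then $\Gamma\vdash e\simeq_{\mathsf E}e:T$. 2. If $\vdash_{\mathsf C}T$ as a source type, then $T\sim_{\mathsf E}T$. Consequently, if $\emptyset\vdash_{\mathsf C}e:T$ as a source program, then either $e\longrightarrow^*_{\mathsf C}\Uparrow l$ and $e\longrightarrow^*_{\mathsf E}\Uparrow l$ for one and the same label $l$, or $e\longrightarrow^*_{\mathsf C}v_1$ and $e\longrightarrow^*_{\mathsf E}v_2$ for values with $v_1\sim_{\mathsf E}v_2:T$. -/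

import Mathlib

universe u

namespace LambdaH

/-- The modes of the calculus that are compared: classic and eidetic. -/
inductive Mode where
  | C
  | E

/-- The base types, constants, operation symbols (with arities) and blame labels over which the
calculus is built. There is a base type of booleans whose constants are exactly `tt` and `ff`. -/
structure Signature where
  Base : Type u
  Const : Type u
  Op : Type u
  Lab : Type u
  boolTy : Base
  tt : Const
  ff : Const
  tyConst : Const → Base
  arity : Op → ℕ
  tt_ne_ff : tt ≠ ff
  tyConst_bool_iff : ∀ k, tyConst k = boolTy ↔ k = tt ∨ k = ff

/-- Locations: `none` is the empty label `•`, `some l` is a proper blame label. -/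
abbrev Label (S : Signature.{u}) : Type u := Option S.Lab

/-- Status of a coercion stack: target type (being) checked, or not yet. -/
inductive Status where
  | checked
  | pending

/-! Syntax, well-scoped with de Bruijn indices: `Term S n` is the type of terms with free variables
in `Fin n` (`0` is the innermost one). Types are closed: the predicate of `{x:B | e}` has `x` as its
only free variable. The terms inside active checks and coercion stacks are closed. -/
mutual

/-- Types `{x:B | e}` and `T₁ → T₂`. -/
inductive Ty (S : Signature.{u}) : Type u where
  | refine (B : S.Base) (e : Term S 1) : Ty S
  | arrow (T₁ T₂ : Ty S) : Ty S

inductive Term (S : Signature.{u}) : ℕ → Type u where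
  | var {n : ℕ} (i : Fin n) : Term S n
  | const {n : ℕ} (k : S.Const) : Term S n
  | lam {n : ℕ} (T : Ty S) (e : Term S (n + 1)) : Term S n
  | app {n : ℕ} (e₁ e₂ : Term S n) : Term S n
  | op {n : ℕ} (o : S.Op) (es : Fin (S.arity o) → Term S n) : Term S n
  /-- The cast `⟨T₁ ⇒ᵃ T₂⟩ˡ e`. -/
  | cast {n : ℕ} (T₁ : Ty S) (a : Ann S) (T₂ : Ty S) (l : Label S) (e : Term S n) : Term S n
  /-- Blame, `⇑l`. -/
  | blame {n : ℕ} (l : Label S) : Term S n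
  /-- The active check `⟨{x:B | e₁}, e₂, k⟩ˡ`. -/
  | check {n : ℕ} (B : S.Base) (e₁ : Term S 1) (e₂ : Term S 0) (k : S.Const) (l : Label S) :
      Term S n
  /-- The coercion stack `⟨{x:B | e₁}, s, r, k, e₂⟩`. -/
  | stack {n : ℕ} (B : S.Base) (e₁ : Term S 1) (s : Status) (r : RList S) (k : S.Const)
      (e₂ : Term S 0) : Term S n

/-- Annotations: the empty annotation `•` or a coercion. -/
inductive Ann (S : Signature.{u}) : Type u where
  | none : Ann S
  | coe (c : Coercion S) : Ann S

/-- Coercions: refinement lists and function coercions `c₁ ↦ c₂`. -/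
inductive Coercion (S : Signature.{u}) : Type u where
  | refs (r : RList S) : Coercion S
  | fn (c₁ c₂ : Coercion S) : Coercion S

/-- Blame-annotated refinement lists: `nil` and `{x:B | e}ˡ, r`. -/
inductive RList (S : Signature.{u}) : Type u where
  | nil : RList S
  | cons (B : S.Base) (e : Term S 1) (l : Label S) (r : RList S) : RList S

end

variable {S : Signature.{u}}

/-- The raw type `{x:B | true}`. -/
def Ty.raw (B : S.Base) : Ty S := .refine B (.const S.tt)

/-! ### Substitution -/

def Term.rename {n m : ℕ} (ρ : Fin n → Fin m) : Term S n → Term S m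
  | .var i => .var (ρ i)
  | .const k => .const k
  | .lam T e => .lam T (e.rename (Fin.cons 0 fun i => (ρ i).succ))
  | .app e₁ e₂ => .app (e₁.rename ρ) (e₂.rename ρ)
  | .op o es => .op o fun i => (es i).rename ρ
  | .cast T₁ a T₂ l e => .cast T₁ a T₂ l (e.rename ρ)
  | .blame l => .blame l
  | .check B e₁ e₂ k l => .check B e₁ e₂ k l
  | .stack B e₁ s r k e₂ => .stack B e₁ s r k e₂

/-- Simultaneous capture-avoiding substitution. -/
def Term.subst {n m : ℕ} (σ : Fin n → Term S m) : Term S n → Term S m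
  | .var i => σ i
  | .const k => .const k
  | .lam T e => .lam T (e.subst (Fin.cons (.var 0) fun i => (σ i).rename Fin.succ))
  | .app e₁ e₂ => .app (e₁.subst σ) (e₂.subst σ)
  | .op o es => .op o fun i => (es i).subst σ
  | .cast T₁ a T₂ l e => .cast T₁ a T₂ l (e.subst σ)
  | .blame l => .blame l
  | .check B e₁ e₂ k l => .check B e₁ e₂ k l
  | .stack B e₁ s r k e₂ => .stack B e₁ s r k e₂

/-- `e[v/x]`, where `x` is the only free variable of `e` and `v` is closed. -/
def Term.inst (e : Term S 1) (v : Term S 0) : Term S 0 := e.subst fun _ => v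

/-! ### Operations -/

/-- Types and (partial) denotations of the operations. The type of `o` is the first-order type
`{x:B₁ | e₁} → ⋯ → {x:Bₙ | eₙ} → {x:B | e}`. -/
structure OpInterp (S : Signature.{u}) where
  argBase : (o : S.Op) → Fin (S.arity o) → S.Base
  argPred : (o : S.Op) → Fin (S.arity o) → Term S 1
  resBase : S.Op → S.Base
  resPred : S.Op → Term S 1
  denote : (o : S.Op) → (Fin (S.arity o) → S.Const) → Option S.Const

/-! ### Coercions -/

/-- A candidate `⊃`: `imp B e₁ e₂` stands for `{x:B | e₁} ⊃ {x:B | e₂}`. -/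
abbrev Implication (S : Signature.{u}) : Type u := S.Base → Term S 1 → Term S 1 → Prop

/-- The refinement types occurring in a refinement list, without their labels. -/
def RList.types : RList S → List (S.Base × Term S 1)
  | .nil => []
  | .cons B e _ r => (B, e) :: r.types

open Classical in
/-- `r \ {x:B | e}`: drop from `r` all the types that `{x:B | e}` implies. -/
noncomputable def RList.drop (imp : Implication S) (B : S.Base) (e : Term S 1) : RList S → RList S
  | .nil => .nil
  | .cons B₁ e₁ l r =>
      if B₁ = B ∧ imp B e e₁ then r.drop imp B e else .cons B₁ e₁ l (r.drop imp B e)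

/-- `r₁ ▷ r₂` on refinement lists. -/
noncomputable def RList.merge (imp : Implication S) : RList S → RList S → RList S
  | .nil, r₂ => r₂
  | .cons B e l r₁, r₂ => .cons B e l ((r₁.merge imp r₂).drop imp B e)

/-- `c₁ ▷ c₂`; undefined when a refinement list meets a function coercion. -/
noncomputable def Coercion.merge (imp : Implication S) :
    Coercion S → Coercion S → Option (Coercion S)
  | .refs r₁, .refs r₂ => some (.refs (r₁.merge imp r₂))
  | .fn c₁₁ c₁₂, .fn c₂₁ c₂₂ =>
      (c₂₁.merge imp c₁₁).bind fun d => (c₁₂.merge imp c₂₂).bind fun c => some (.fn d c)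
  | .refs _, .fn _ _ => none
  | .fn _ _, .refs _ => none
termination_by c₁ c₂ => sizeOf c₁ + sizeOf c₂

open Classical in
/-- `coerce(T₁, T₂, l)`; undefined when `T₁` and `T₂` do not have the same skeleton. -/
noncomputable def coerce (l : Label S) : Ty S → Ty S → Option (Coercion S)
  | .refine B₁ _, .refine B₂ e₂ =>
      if B₁ = B₂ then some (.refs (.cons B₂ e₂ l .nil)) else none
  | .arrow T₁₁ T₁₂, .arrow T₂₁ T₂₂ =>
      (coerce l T₂₁ T₁₁).bind fun d => (coerce l T₁₂ T₂₂).bind fun c => some (.fn d c)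
  | .refine _ _, .arrow _ _ => none
  | .arrow _ _, .refine _ _ => none
termination_by T₁ T₂ => sizeOf T₁ + sizeOf T₂

def Ann.dom : Ann S → Option (Ann S)
  | .none => some .none
  | .coe (.fn c₁ _) => some (.coe c₁)
  | .coe (.refs _) => Option.none

def Ann.cod : Ann S → Option (Ann S)
  | .none => some .none
  | .coe (.fn _ c₂) => some (.coe c₂)
  | .coe (.refs _) => Option.none

open Classical in
/-- `s ∨ P`. -/
noncomputable def Status.or (s : Status) (P : Prop) : Status :=
  match s with
  | .checked => .checked
  | .pending => if P then .checked else .pending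

/-! ### Operational semantics -/

/-- `val_m e` for closed terms. -/
inductive Val : Mode → Term S 0 → Prop where
  | const {m : Mode} (k : S.Const) : Val m (.const k)
  | lam {m : Mode} (T : Ty S) (e : Term S 1) : Val m (.lam T e)
  | proxyC {T₁₁ T₁₂ T₂₁ T₂₂ : Ty S} {l : Label S} {e : Term S 0} (he : Val .C e) :
      Val .C (.cast (.arrow T₁₁ T₁₂) .none (.arrow T₂₁ T₂₂) l e)
  | proxyE (T₁₁ T₁₂ T₂₁ T₂₂ T : Ty S) (c₁ c₂ : Coercion S) (e : Term S 1) :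
      Val .E (.cast (.arrow T₁₁ T₁₂) (.coe (.fn c₁ c₂)) (.arrow T₂₁ T₂₂) none (.lam T e))

/-- One-step reduction of closed terms in mode `m`. -/
inductive Step (O : OpInterp S) (imp : Implication S) : Mode → Term S 0 → Term S 0 → Prop where
  | beta {m : Mode} {T : Ty S} {e₁ : Term S 1} {e₂ : Term S 0} (h : Val m e₂) :
      Step O imp m (.app (.lam T e₁) e₂) (e₁.inst e₂)
  | op {m : Mode} {o : S.Op} {ks : Fin (S.arity o) → S.Const} {k : S.Const}
      (h : O.denote o ks = some k) :
      Step O imp m (.op o fun i => .const (ks i)) (.const k)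
  | unwrap {m : Mode} {T₁₁ T₁₂ T₂₁ T₂₂ : Ty S} {a a₁ a₂ : Ann S} {l : Label S}
      {e₁ e₂ : Term S 0} (h₁ : Val m (.cast (.arrow T₁₁ T₁₂) a (.arrow T₂₁ T₂₂) l e₁))
      (h₂ : Val m e₂) (hd : a.dom = some a₁) (hc : a.cod = some a₂) :
      Step O imp m (.app (.cast (.arrow T₁₁ T₁₂) a (.arrow T₂₁ T₂₂) l e₁) e₂)
        (.cast T₁₂ a₂ T₂₂ l (.app e₁ (.cast T₂₁ a₁ T₁₁ l e₂)))
  | appL {m : Mode} {e₁ e₁' e₂ : Term S 0} (h : Step O imp m e₁ e₁') :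
      Step O imp m (.app e₁ e₂) (.app e₁' e₂)
  | appR {m : Mode} {e₁ e₂ e₂' : Term S 0} (hv : Val m e₁) (h : Step O imp m e₂ e₂') :
      Step O imp m (.app e₁ e₂) (.app e₁ e₂')
  | opInner {m : Mode} {o : S.Op} {es : Fin (S.arity o) → Term S 0} (i : Fin (S.arity o))
      {e' : Term S 0} (hv : ∀ j, j < i → Val m (es j)) (h : Step O imp m (es i) e') :
      Step O imp m (.op o es) (.op o (Function.update es i e'))
  | appRaiseL {m : Mode} {l : Label S} {e₂ : Term S 0} :
      Step O imp m (.app (.blame l) e₂) (.blame l)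
  | appRaiseR {m : Mode} {e₁ : Term S 0} {l : Label S} (hv : Val m e₁) :
      Step O imp m (.app e₁ (.blame l)) (.blame l)
  | opRaise {m : Mode} {o : S.Op} {es : Fin (S.arity o) → Term S 0} (i : Fin (S.arity o))
      {l : Label S} (hv : ∀ j, j < i → Val m (es j)) (h : es i = .blame l) :
      Step O imp m (.op o es) (.blame l)
  | checkOK {m : Mode} {B : S.Base} {e₁ : Term S 1} {k : S.Const} {l : Label S} :
      Step O imp m (.check B e₁ (.const S.tt) k l) (.const k)
  | checkFail {m : Mode} {B : S.Base} {e₁ : Term S 1} {k : S.Const} {l : Label S} :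
      Step O imp m (.check B e₁ (.const S.ff) k l) (.blame l)
  | checkInner {m : Mode} {B : S.Base} {e₁ : Term S 1} {e₂ e₂' : Term S 0} {k : S.Const}
      {l : Label S} (h : Step O imp m e₂ e₂') :
      Step O imp m (.check B e₁ e₂ k l) (.check B e₁ e₂' k l)
  | checkRaise {m : Mode} {B : S.Base} {e₁ : Term S 1} {k : S.Const} {l l' : Label S} :
      Step O imp m (.check B e₁ (.blame l') k l) (.blame l')
  -- classic rules for casts
  | checkNone {B : S.Base} {e₁ e₂ : Term S 1} {l : Label S} {k : S.Const} :
      Step O imp .C (.cast (.refine B e₁) .none (.refine B e₂) l (.const k))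
        (.check B e₂ (e₂.inst (.const k)) k l)
  | castInnerC {T₁ T₂ : Ty S} {l : Label S} {e e' : Term S 0} (h : Step O imp .C e e') :
      Step O imp .C (.cast T₁ .none T₂ l e) (.cast T₁ .none T₂ l e')
  | castRaiseC {T₁ T₂ : Ty S} {l l' : Label S} :
      Step O imp .C (.cast T₁ .none T₂ l (.blame l')) (.blame l')
  -- eidetic rules for casts
  | coerce {T₁ T₂ : Ty S} {l : Label S} {e : Term S 0} {c : Coercion S}
      (h : LambdaH.coerce l T₁ T₂ = some c) :
      Step O imp .E (.cast T₁ .none T₂ l e) (.cast T₁ (.coe c) T₂ none e)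
  | castInnerE {T₁ T₂ : Ty S} {c : Coercion S} {l : Label S} {e e' : Term S 0}
      (hne : ∀ T T' c' l' e'', e ≠ .cast T (.coe c') T' l' e'') (h : Step O imp .E e e') :
      Step O imp .E (.cast T₁ (.coe c) T₂ l e) (.cast T₁ (.coe c) T₂ l e')
  | castMerge {T₁ T₂ T₃ : Ty S} {c₁ c₂ c : Coercion S} {l l' : Label S} {e : Term S 0}
      (h : c₁.merge imp c₂ = some c) :
      Step O imp .E (.cast T₂ (.coe c₂) T₃ l (.cast T₁ (.coe c₁) T₂ l' e))
        (.cast T₁ (.coe c) T₃ l e)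
  | castRaiseE {T₁ T₂ : Ty S} {c : Coercion S} {l l' : Label S} :
      Step O imp .E (.cast T₁ (.coe c) T₂ l (.blame l')) (.blame l')
  | coerceStack {B : S.Base} {e₁ e₂ : Term S 1} {r : RList S} {k : S.Const} {l : Label S} :
      Step O imp .E (.cast (.refine B e₁) (.coe (.refs r)) (.refine B e₂) l (.const k))
        (.stack B e₂ .pending r k (.const k))
  | stackPop {B : S.Base} {e e' : Term S 1} {s : Status} {l : Label S} {r : RList S}
      {k : S.Const} :
      Step O imp .E (.stack B e s (.cons B e' l r) k (.const k))
        (.stack B e (s.or (e' = e ∨ imp B e' e)) r k (.check B e' (e'.inst (.const k)) k l))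
  | stackInner {B : S.Base} {e₁ : Term S 1} {s : Status} {r : RList S} {k : S.Const}
      {e e' : Term S 0} (h : Step O imp .E e e') :
      Step O imp .E (.stack B e₁ s r k e) (.stack B e₁ s r k e')
  | stackRaise {B : S.Base} {e₁ : Term S 1} {s : Status} {r : RList S} {k : S.Const}
      {l : Label S} :
      Step O imp .E (.stack B e₁ s r k (.blame l)) (.blame l)
  | stackDone {B : S.Base} {e₁ : Term S 1} {k : S.Const} :
      Step O imp .E (.stack B e₁ .checked .nil k (.const k)) (.const k)

/-- Many-step reduction `e ⟶*_m e'`. -/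
def Steps (O : OpInterp S) (imp : Implication S) (m : Mode) : Term S 0 → Term S 0 → Prop :=
  Relation.ReflTransGen (Step O imp m)

/-! ### Typing -/

/-- Type compatibility `⊢ T₁ ∥ T₂`. -/
inductive Compat : Ty S → Ty S → Prop where
  | refine (B : S.Base) (e₁ e₂ : Term S 1) : Compat (.refine B e₁) (.refine B e₂)
  | arrow {T₁₁ T₁₂ T₂₁ T₂₂ : Ty S} (h₁ : Compat T₁₁ T₂₁) (h₂ : Compat T₁₂ T₂₂) :
      Compat (.arrow T₁₁ T₁₂) (.arrow T₂₁ T₂₂)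

/-! The typing judgments. The flag `src` is `true` for the derivations of source programs: there
constants only get their raw type, casts have the empty annotation and a proper blame label, and
the rules for run-time terms (blame, coercions, active checks, stacks) are not available.
A context is well formed when all its types are, which is spelled out in the rules. -/
mutual

/-- Type well-formedness `⊢_m T`. -/
inductive WfTy (O : OpInterp S) (imp : Implication S) : Mode → Bool → Ty S → Prop where
  | base {m : Mode} {src : Bool} (B : S.Base) : WfTy O imp m src (Ty.raw B)
  | refine {m : Mode} {src : Bool} {B : S.Base} {e : Term S 1}
      (h : Typed O imp m src (fun _ => Ty.raw B) e (Ty.raw S.boolTy)) :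
      WfTy O imp m src (.refine B e)
  | arrow {m : Mode} {src : Bool} {T₁ T₂ : Ty S} (h₁ : WfTy O imp m src T₁)
      (h₂ : WfTy O imp m src T₂) : WfTy O imp m src (.arrow T₁ T₂)

/-- Coercion well-formedness `⊢_E c ∥ T₁ ⇒ T₂`. -/
inductive WfCoercion (O : OpInterp S) (imp : Implication S) :
    Coercion S → Ty S → Ty S → Prop where
  | refs {B : S.Base} {e₁ e₂ : Term S 1} {r : RList S}
      (h₁ : WfTy O imp .E false (.refine B e₁)) (h₂ : WfTy O imp .E false (.refine B e₂))
      (hB : ∀ p ∈ r.types, p.1 = B) (hr : ∀ p ∈ r.types, WfTy O imp .E false (.refine p.1 p.2))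
      (hnodup : r.types.Nodup) (himp : ∃ e, (B, e) ∈ r.types ∧ imp B e e₂) :
      WfCoercion O imp (.refs r) (.refine B e₁) (.refine B e₂)
  | fn {T₁₁ T₁₂ T₂₁ T₂₂ : Ty S} {c₁ c₂ : Coercion S} (h₁ : WfCoercion O imp c₁ T₂₁ T₁₁)
      (h₂ : WfCoercion O imp c₂ T₁₂ T₂₂) :
      WfCoercion O imp (.fn c₁ c₂) (.arrow T₁₁ T₁₂) (.arrow T₂₁ T₂₂)

/-- Term typing `Γ ⊢_m e : T`. -/
inductive Typed (O : OpInterp S) (imp : Implication S) :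
    Mode → Bool → {n : ℕ} → (Fin n → Ty S) → Term S n → Ty S → Prop where
  | var {m : Mode} {src : Bool} {n : ℕ} {Γ : Fin n → Ty S} (hΓ : ∀ i, WfTy O imp m src (Γ i))
      (i : Fin n) : Typed O imp m src Γ (.var i) (Γ i)
  | const {m : Mode} {src : Bool} {n : ℕ} {Γ : Fin n → Ty S} {k : S.Const} {B : S.Base}
      {e : Term S 1} (hΓ : ∀ i, WfTy O imp m src (Γ i)) (hk : S.tyConst k = B)
      (hT : WfTy O imp m src (.refine B e)) (he : Steps O imp m (e.inst (.const k)) (.const S.tt))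
      (hsrc : src = true → e = .const S.tt) :
      Typed O imp m src Γ (.const k) (.refine B e)
  | lam {m : Mode} {src : Bool} {n : ℕ} {Γ : Fin n → Ty S} {T₁ T₂ : Ty S} {e : Term S (n + 1)}
      (hT : WfTy O imp m src T₁)
      (he : Typed O imp m src (Fin.cons (α := fun _ => Ty S) T₁ Γ) e T₂) :
      Typed O imp m src Γ (.lam T₁ e) (.arrow T₁ T₂)
  | app {m : Mode} {src : Bool} {n : ℕ} {Γ : Fin n → Ty S} {T₁ T₂ : Ty S} {e₁ e₂ : Term S n}
      (h₁ : Typed O imp m src Γ e₁ (.arrow T₁ T₂)) (h₂ : Typed O imp m src Γ e₂ T₁) :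
      Typed O imp m src Γ (.app e₁ e₂) T₂
  | op {m : Mode} {src : Bool} {n : ℕ} {Γ : Fin n → Ty S} {o : S.Op}
      {es : Fin (S.arity o) → Term S n} (hΓ : ∀ i, WfTy O imp m src (Γ i))
      (h : ∀ i, Typed O imp m src Γ (es i) (.refine (O.argBase o i) (O.argPred o i))) :
      Typed O imp m src Γ (.op o es) (.refine (O.resBase o) (O.resPred o))
  | cast {m : Mode} {src : Bool} {n : ℕ} {Γ : Fin n → Ty S} {T₁ T₂ : Ty S} {l : Label S}
      {e : Term S n} (h₁ : WfTy O imp m src T₁) (h₂ : WfTy O imp m src T₂) (hc : Compat T₁ T₂)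
      (he : Typed O imp m src Γ e T₁) (hsrc : src = true → l ≠ none) :
      Typed O imp m src Γ (.cast T₁ .none T₂ l e) T₂
  | coercion {n : ℕ} {Γ : Fin n → Ty S} {T₁ T₂ : Ty S} {c : Coercion S} {e : Term S n}
      (hc : WfCoercion O imp c T₁ T₂) (he : Typed O imp .E false Γ e T₁) :
      Typed O imp .E false Γ (.cast T₁ (.coe c) T₂ none e) T₂
  | blame {m : Mode} {n : ℕ} {Γ : Fin n → Ty S} {T : Ty S} {l : Label S}
      (hΓ : ∀ i, WfTy O imp m false (Γ i)) (hT : WfTy O imp m false T) :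
      Typed O imp m false Γ (.blame l) T
  | check {m : Mode} {n : ℕ} {Γ : Fin n → Ty S} {B : S.Base} {e₁ : Term S 1} {e₂ : Term S 0}
      {k : S.Const} {l : Label S} (hΓ : ∀ i, WfTy O imp m false (Γ i))
      (hT : WfTy O imp m false (.refine B e₁)) (hk : S.tyConst k = B)
      (he : Typed O imp m false Fin.elim0 e₂ (Ty.raw S.boolTy))
      (hred : Steps O imp m (e₁.inst (.const k)) e₂) :
      Typed O imp m false Γ (.check B e₁ e₂ k l) (.refine B e₁)
  /-- The checking term is the scrutinee, an active check of it, or the blame which that check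
  raised. -/
  | stack {n : ℕ} {Γ : Fin n → Ty S} {B : S.Base} {e₁ e' : Term S 1} {e₂ : Term S 0} {s : Status}
      {r : RList S} {k : S.Const} (hΓ : ∀ i, WfTy O imp .E false (Γ i))
      (hT : WfTy O imp .E false (.refine B e₁)) (hk : S.tyConst k = B)
      (hB : ∀ p ∈ r.types, p.1 = B) (hr : ∀ p ∈ r.types, WfTy O imp .E false (.refine p.1 p.2))
      (hnodup : r.types.Nodup)
      (hshape : e₂ = .const k ∨ (∃ e e₃ l, e₂ = .check B e e₃ k l) ∨ ∃ l, e₂ = .blame l)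
      (he : Typed O imp .E false Fin.elim0 e₂ (.refine B e'))
      (hpending : s = .pending → ∃ e, (B, e) ∈ r.types ∧ imp B e e₁)
      (hchecked : s = .checked → Steps O imp .E (e₁.inst (.const k)) (.const S.tt) ∨
        ∃ e l, imp B e e₁ ∧ Steps O imp .E (.check B e (e.inst (.const k)) k l) e₂) :
      Typed O imp .E false Γ (.stack B e₁ s r k e₂) (.refine B e₁)

end

/-! ### Standing assumptions on the parameters -/

/-- The types of the operations are well formed and consistent with their denotations. -/
structure OpInterp.Lawful (O : OpInterp S) (imp : Implication S) : Prop where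
  wf_arg : ∀ m o i, WfTy O imp m false (.refine (O.argBase o i) (O.argPred o i))
  wf_res : ∀ m o, WfTy O imp m false (.refine (O.resBase o) (O.resPred o))
  defined_iff : ∀ m o ks, (∀ i, S.tyConst (ks i) = O.argBase o i) →
    ((∃ k, O.denote o ks = some k) ↔
      ∀ i, Steps O imp m ((O.argPred o i).inst (.const (ks i))) (.const S.tt))
  res_ok : ∀ m o ks k, (∀ i, S.tyConst (ks i) = O.argBase o i) → O.denote o ks = some k →
    S.tyConst k = O.resBase o ∧ Steps O imp m ((O.resPred o).inst (.const k)) (.const S.tt)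

/-- The axioms for `⊃`: an adequate pre-order. -/
structure ImplicationLaws (O : OpInterp S) (imp : Implication S) : Prop where
  refl : ∀ B e, WfTy O imp .E false (.refine B e) → imp B e e
  trans : ∀ B e₁ e₂ e₃, imp B e₁ e₂ → imp B e₂ e₃ → imp B e₁ e₃
  adequate : ∀ B e₁ e₂, imp B e₁ e₂ → ∀ k, S.tyConst k = B →
    Steps O imp .E (e₁.inst (.const k)) (.const S.tt) →
    Steps O imp .E (e₂.inst (.const k)) (.const S.tt)

/-! ### The blame-exact logical relation -/

/-- The term rule, relative to a relation `V` on values: the classic term `e₁` and the eidetic term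
`e₂` raise the same blame or reduce to values related by `V`. -/
def TermRelOf (O : OpInterp S) (imp : Implication S) (V : Term S 0 → Term S 0 → Prop)
    (e₁ e₂ : Term S 0) : Prop :=
  (∃ l, Steps O imp .C e₁ (.blame l) ∧ Steps O imp .E e₂ (.blame l)) ∨
  ∃ v₁ v₂, Steps O imp .C e₁ v₁ ∧ Val .C v₁ ∧ Steps O imp .E e₂ v₂ ∧ Val .E v₂ ∧ V v₁ v₂

/-- The value relation `v₁ ∼_E v₂ : T`. The index `T` is an eidetic type, and at function types the
eidetic value has to be well typed at it. -/
def ValRel (O : OpInterp S) (imp : Implication S) : Ty S → Term S 0 → Term S 0 → Prop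
  | .refine B e, v₁, v₂ => ∃ k, v₁ = .const k ∧ v₂ = .const k ∧ S.tyConst k = B ∧
      Steps O imp .E (e.inst (.const k)) (.const S.tt)
  | .arrow T₁ T₂, v₁, v₂ => Val .C v₁ ∧ Val .E v₂ ∧
      Typed O imp .E false Fin.elim0 v₂ (.arrow T₁ T₂) ∧
      ∀ u₁ u₂, ValRel O imp T₁ u₁ u₂ →
        TermRelOf O imp (ValRel O imp T₂) (.app v₁ u₁) (.app v₂ u₂)

/-- The term relation `e₁ ≃_E e₂ : T` on closed terms. -/
def TermRel (O : OpInterp S) (imp : Implication S) (T : Ty S) : Term S 0 → Term S 0 → Prop :=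
  TermRelOf O imp (ValRel O imp T)

/-- The type relation `T₁ ∼_E T₂`. -/
def TyRel (O : OpInterp S) (imp : Implication S) : Ty S → Ty S → Prop
  | .refine B₁ e₁, .refine B₂ e₂ => B₁ = B₂ ∧ ∀ v₁ v₂, ValRel O imp (Ty.raw B₁) v₁ v₂ →
      TermRel O imp (Ty.raw S.boolTy) (e₁.inst v₁) (e₂.inst v₂)
  | .arrow T₁₁ T₁₂, .arrow T₂₁ T₂₂ => TyRel O imp T₁₁ T₂₁ ∧ TyRel O imp T₁₂ T₂₂
  | .refine _ _, .arrow _ _ => False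
  | .arrow _ _, .refine _ _ => False

/-- Closing substitutions `Γ ⊨_E δ`, where `δ` is the pair `(δ₁, δ₂)`. -/
def SubstRel (O : OpInterp S) (imp : Implication S) {n : ℕ} (Γ : Fin n → Ty S)
    (δ₁ δ₂ : Fin n → Term S 0) : Prop :=
  ∀ i, ValRel O imp (Γ i) (δ₁ i) (δ₂ i)

/-- Open terms: `Γ ⊢ e₁ ≃_E e₂ : T`. -/
def OpenRel (O : OpInterp S) (imp : Implication S) {n : ℕ} (Γ : Fin n → Ty S) (e₁ e₂ : Term S n)
    (T : Ty S) : Prop :=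
  ∀ δ₁ δ₂, SubstRel O imp Γ δ₁ δ₂ → TermRel O imp T (e₁.subst δ₁) (e₂.subst δ₂)

end LambdaH

open LambdaH

/-!
# Classic and eidetic source programs agree up to blame

The proof is a logical-relations argument. All of it is routine except for casts: a classic cast
checks, or wraps, the *value* of its body, whereas an eidetic coercion merges with the coercions
that it meets in its body *before* the body is evaluated, and merging deletes checks.

The bridge is a fact about eidetic evaluation alone, `evals_coercion_iff`: a well-typed coercion
`⟨T₁ ⇒ᶜ T₂⟩ e` has exactly the outcomes that one gets by evaluating `e` first and then applying the
coercion to its value (or blame). It rests on `Step.evals_coercion_iff`, which says that reducing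
the body of a coercion does not change the outcome. There are two interesting cases. If the body
consists of two coercions which merge, the two orders of merging lead to the same term, since
merging is associative (`Coercion.merge_assoc`, by transitivity of `⊃`). If the body is a coercion
of a constant, which becomes a stack, then running the merged list of checks has the same outcome
as running the two lists one after the other (`RList.checks_merge_iff`): a check is deleted only
when an earlier one implies it, and if that earlier check has succeeded then, by adequacy of `⊃`,
so would the deleted one. Determinism of eidetic reduction makes outcomes invariant under
reduction, and preservation (`Typed.step`) keeps the coercions well formed, so that merging is defined.

With this, a cast relates to its coercion as follows. At refinements, both sides check the target
predicate, on which they agree by the type relation (`CastRel.refine`). At function types, the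
eidetic proxy obtained by merging has the same outcomes as an unmerged proxy around the original
function (`exists_proxy`), and that one unwraps in step with the classic proxy (`CastRel.arrow`).
The fundamental property (`Typed.openRel`, `WfTy.tyRel`) follows by induction on derivations.
-/

namespace LambdaH

variable {S : Signature.{u}} {O : OpInterp S} {imp : Implication S}

/-! ### Substitution -/

theorem Term.subst_rename : ∀ {n m p : ℕ} (ρ : Fin n → Fin m) (σ : Fin m → Term S p)
    (e : Term S n), (e.rename ρ).subst σ = e.subst fun i => σ (ρ i)
  | _, _, _, ρ, σ, .var i => rfl
  | _, _, _, ρ, σ, .const k => rfl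
  | _, _, _, ρ, σ, .lam T e => by
    simp only [Term.rename, Term.subst, Term.subst_rename _ _ e]
    congr 2
    funext i
    refine Fin.cases ?_ (fun j => ?_) i <;> simp
  | _, _, _, ρ, σ, .app e₁ e₂ => by
    simp only [Term.rename, Term.subst, Term.subst_rename _ _ e₁, Term.subst_rename _ _ e₂]
  | _, _, _, ρ, σ, .op o es => by
    simp only [Term.rename, Term.subst]
    congr 1
    funext i
    exact Term.subst_rename _ _ (es i)
  | _, _, _, ρ, σ, .cast T₁ a T₂ l e => by
    simp only [Term.rename, Term.subst, Term.subst_rename _ _ e]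
  | _, _, _, ρ, σ, .blame l => rfl
  | _, _, _, ρ, σ, .check B e₁ e₂ k l => rfl
  | _, _, _, ρ, σ, .stack B e₁ s r k e₂ => rfl

theorem Term.rename_rename : ∀ {n m p : ℕ} (ρ : Fin n → Fin m) (τ : Fin m → Fin p)
    (e : Term S n), (e.rename ρ).rename τ = e.rename fun i => τ (ρ i)
  | _, _, _, ρ, τ, .var i => rfl
  | _, _, _, ρ, τ, .const k => rfl
  | _, _, _, ρ, τ, .lam T e => by
    simp only [Term.rename, Term.rename_rename _ _ e]
    congr 2
    funext i
    refine Fin.cases ?_ (fun j => ?_) i <;> simp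
  | _, _, _, ρ, τ, .app e₁ e₂ => by
    simp only [Term.rename, Term.rename_rename _ _ e₁, Term.rename_rename _ _ e₂]
  | _, _, _, ρ, τ, .op o es => by
    simp only [Term.rename]
    congr 1
    funext i
    exact Term.rename_rename _ _ (es i)
  | _, _, _, ρ, τ, .cast T₁ a T₂ l e => by
    simp only [Term.rename, Term.rename_rename _ _ e]
  | _, _, _, ρ, τ, .blame l => rfl
  | _, _, _, ρ, τ, .check B e₁ e₂ k l => rfl
  | _, _, _, ρ, τ, .stack B e₁ s r k e₂ => rfl

theorem Term.rename_subst : ∀ {n m p : ℕ} (σ : Fin n → Term S m) (τ : Fin m → Fin p)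
    (e : Term S n), (e.subst σ).rename τ = e.subst fun i => (σ i).rename τ
  | _, _, _, σ, τ, .var i => rfl
  | _, _, _, σ, τ, .const k => rfl
  | _, _, _, σ, τ, .lam T e => by
    simp only [Term.rename, Term.subst, Term.rename_subst _ _ e]
    congr 2
    funext i
    refine Fin.cases ?_ (fun j => ?_) i <;> simp [Term.rename, Term.rename_rename]
  | _, _, _, σ, τ, .app e₁ e₂ => by
    simp only [Term.rename, Term.subst, Term.rename_subst _ _ e₁, Term.rename_subst _ _ e₂]
  | _, _, _, σ, τ, .op o es => by
    simp only [Term.rename, Term.subst]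
    congr 1
    funext i
    exact Term.rename_subst _ _ (es i)
  | _, _, _, σ, τ, .cast T₁ a T₂ l e => by
    simp only [Term.rename, Term.subst, Term.rename_subst _ _ e]
  | _, _, _, σ, τ, .blame l => rfl
  | _, _, _, σ, τ, .check B e₁ e₂ k l => rfl
  | _, _, _, σ, τ, .stack B e₁ s r k e₂ => rfl

theorem Term.subst_subst : ∀ {n m p : ℕ} (σ : Fin n → Term S m) (τ : Fin m → Term S p)
    (e : Term S n), (e.subst σ).subst τ = e.subst fun i => (σ i).subst τ
  | _, _, _, σ, τ, .var i => rfl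
  | _, _, _, σ, τ, .const k => rfl
  | _, _, _, σ, τ, .lam T e => by
    simp only [Term.subst, Term.subst_subst _ _ e]
    congr 2
    funext i
    refine Fin.cases ?_ (fun j => ?_) i <;>
      simp [Term.subst, Term.subst_rename, Term.rename_subst]
  | _, _, _, σ, τ, .app e₁ e₂ => by
    simp only [Term.subst, Term.subst_subst _ _ e₁, Term.subst_subst _ _ e₂]
  | _, _, _, σ, τ, .op o es => by
    simp only [Term.subst]
    congr 1
    funext i
    exact Term.subst_subst _ _ (es i)
  | _, _, _, σ, τ, .cast T₁ a T₂ l e => by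
    simp only [Term.subst, Term.subst_subst _ _ e]
  | _, _, _, σ, τ, .blame l => rfl
  | _, _, _, σ, τ, .check B e₁ e₂ k l => rfl
  | _, _, _, σ, τ, .stack B e₁ s r k e₂ => rfl

theorem Term.subst_var : ∀ {n : ℕ} (e : Term S n), e.subst .var = e
  | _, .var i => rfl
  | _, .const k => rfl
  | n, .lam T e => by
    have h : (Fin.cons (α := fun _ => Term S (n + 1)) (.var 0)
        fun i => (Term.var i).rename Fin.succ) = .var := by
      funext i
      refine Fin.cases ?_ (fun j => ?_) i <;> simp [Term.rename]
    simp only [Term.subst]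
    rw [h, Term.subst_var e]
  | _, .app e₁ e₂ => by simp only [Term.subst, Term.subst_var e₁, Term.subst_var e₂]
  | _, .op o es => by
    simp only [Term.subst]
    congr 1
    funext i
    exact Term.subst_var (es i)
  | _, .cast T₁ a T₂ l e => by simp only [Term.subst, Term.subst_var e]
  | _, .blame l => rfl
  | _, .check B e₁ e₂ k l => rfl
  | _, .stack B e₁ s r k e₂ => rfl

theorem Term.subst_closed (e : Term S 0) (σ : Fin 0 → Term S 0) : e.subst σ = e := by
  rw [Subsingleton.elim σ .var, Term.subst_var]

/-- The contractum of `(δ(λx. e)) v` is `e` under the extension of `δ` by `v`. -/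
theorem Term.inst_subst_lift {n : ℕ} (δ : Fin n → Term S 0) (e : Term S (n + 1)) (v : Term S 0) :
    (e.subst (Fin.cons (.var 0) fun i => (δ i).rename Fin.succ)).inst v =
      e.subst (Fin.cons v δ) := by
  rw [Term.inst, Term.subst_subst]
  congr 1
  funext i
  refine Fin.cases ?_ (fun j => ?_) i
  · simp [Term.subst]
  · simp [Term.subst_rename, Term.subst_closed]

/-! ### Basic properties of typing -/


mutual

/-- Well-formedness of source types does not depend on the mode, since source constants only have
raw types. -/
theorem WfTy.eidetic {m : Mode} {src : Bool} {T : Ty S} :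
    WfTy O imp m src T → src = true → WfTy O imp .E false T
  | .base B, _ => .base B
  | .refine h, hs => .refine (h.eidetic hs)
  | .arrow h₁ h₂, hs => .arrow (h₁.eidetic hs) (h₂.eidetic hs)

/-- Source programs have the same types in the eidetic mode, and also when run-time terms are
allowed. -/
theorem Typed.eidetic {m : Mode} {src : Bool} {n : ℕ} {Γ : Fin n → Ty S} {e : Term S n}
    {T : Ty S} : Typed O imp m src Γ e T → src = true → Typed O imp .E false Γ e T
  | .var hΓ i, hs => .var (fun j => (hΓ j).eidetic hs) i
  | .const (k := k) (e := e) hΓ hk hT he hsrc, hs =>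
    .const (fun j => (hΓ j).eidetic hs) hk (hT.eidetic hs)
      (by rw [hsrc hs]; exact .refl) (fun h => nomatch h)
  | .lam hT he, hs => .lam (hT.eidetic hs) (he.eidetic hs)
  | .app h₁ h₂, hs => .app (h₁.eidetic hs) (h₂.eidetic hs)
  | .op hΓ h, hs => .op (fun j => (hΓ j).eidetic hs) (fun i => (h i).eidetic hs)
  | .cast h₁ h₂ hc he _, hs =>
    .cast (h₁.eidetic hs) (h₂.eidetic hs) hc (he.eidetic hs) (fun h => nomatch h)

end

theorem Typed.wf_ctx {m : Mode} {src : Bool} {n : ℕ} {Γ : Fin n → Ty S} {e : Term S n}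
    {T : Ty S} : Typed O imp m src Γ e T → ∀ i, WfTy O imp m src (Γ i)
  | .var hΓ _ => hΓ
  | .const hΓ _ _ _ _ => hΓ
  | .lam _ he => fun i => by simpa using he.wf_ctx i.succ
  | .app h₁ _ => h₁.wf_ctx
  | .op hΓ _ => hΓ
  | .cast _ _ _ he _ => he.wf_ctx
  | .coercion _ he => he.wf_ctx
  | .blame hΓ _ => hΓ
  | .check hΓ _ _ _ _ => hΓ
  | .stack hΓ _ _ _ _ _ _ _ _ _ => hΓ

theorem WfTy.arrow_inv {m : Mode} {src : Bool} {T₁ T₂ : Ty S}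
    (h : WfTy O imp m src (.arrow T₁ T₂)) : WfTy O imp m src T₁ ∧ WfTy O imp m src T₂ := by
  generalize hT : Ty.arrow T₁ T₂ = T at h
  cases h with
  | base B => simp [Ty.raw] at hT
  | refine h => simp at hT
  | arrow h₁ h₂ => cases hT; exact ⟨h₁, h₂⟩

theorem WfCoercion.wf : ∀ {c : Coercion S} {T₁ T₂ : Ty S}, WfCoercion O imp c T₁ T₂ →
    WfTy O imp .E false T₁ ∧ WfTy O imp .E false T₂
  | _, _, _, .refs h₁ h₂ _ _ _ _ => ⟨h₁, h₂⟩
  | _, _, _, .fn h₁ h₂ => ⟨.arrow h₁.wf.2 h₂.wf.1, .arrow h₁.wf.1 h₂.wf.2⟩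

theorem Typed.wf (hO : O.Lawful imp) {m : Mode} {n : ℕ} {Γ : Fin n → Ty S} {e : Term S n}
    {T : Ty S} (h : Typed O imp m false Γ e T) : WfTy O imp m false T := by
  generalize hs : false = src at h
  match h with
  | .var hΓ i => exact hΓ i
  | .const _ _ hT _ _ => exact hT
  | .lam hT he => subst hs; exact .arrow hT (he.wf hO)
  | .app h₁ _ => subst hs; exact (h₁.wf hO).arrow_inv.2
  | .op _ _ => subst hs; exact hO.wf_res _ _
  | .cast _ h₂ _ _ _ => exact h₂
  | .coercion hc _ => exact hc.wf.2
  | .blame _ hT => exact hT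
  | .check _ hT _ _ _ => exact hT
  | .stack _ hT _ _ _ _ _ _ _ _ => exact hT

theorem Typed.rename {m : Mode} {src : Bool} {n p : ℕ} {Γ : Fin n → Ty S} {Δ : Fin p → Ty S}
    (ρ : Fin n → Fin p) {e : Term S n} {T : Ty S} (hΔ : ∀ i, WfTy O imp m src (Δ i))
    (hρ : ∀ i, Δ (ρ i) = Γ i) (h : Typed O imp m src Γ e T) :
    Typed O imp m src Δ (e.rename ρ) T := by
  match h with
  | .var _ i => rw [← hρ i]; exact .var hΔ _
  | .const _ hk hT he hsrc => exact .const hΔ hk hT he hsrc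
  | .lam hT he =>
    refine .lam hT (he.rename _ (fun i => ?_) fun i => ?_)
    · refine Fin.cases ?_ (fun j => ?_) i <;> simp [hT, hΔ]
    · refine Fin.cases ?_ (fun j => ?_) i <;> simp [hρ]
  | .app h₁ h₂ => exact .app (h₁.rename ρ hΔ hρ) (h₂.rename ρ hΔ hρ)
  | .op _ h => exact .op hΔ fun i => (h i).rename ρ hΔ hρ
  | .cast h₁ h₂ hc he hsrc => exact .cast h₁ h₂ hc (he.rename ρ hΔ hρ) hsrc
  | .coercion hc he => exact .coercion hc (he.rename ρ hΔ hρ)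
  | .blame _ hT => exact .blame hΔ hT
  | .check _ hT hk he hred => exact .check hΔ hT hk he hred
  | .stack _ hT hk hB hr hn hsh he hp hc => exact .stack hΔ hT hk hB hr hn hsh he hp hc

theorem Typed.subst {m : Mode} {src : Bool} {n p : ℕ} {Γ : Fin n → Ty S} {Δ : Fin p → Ty S}
    (σ : Fin n → Term S p) {e : Term S n} {T : Ty S} (hΔ : ∀ i, WfTy O imp m src (Δ i))
    (hσ : ∀ i, Typed O imp m src Δ (σ i) (Γ i)) (h : Typed O imp m src Γ e T) :
    Typed O imp m src Δ (e.subst σ) T := by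
  match h with
  | .var _ i => exact hσ i
  | .const _ hk hT he hsrc => exact .const hΔ hk hT he hsrc
  | .lam (T₁ := T₁) hT he =>
    have hΔ' : ∀ i, WfTy O imp m src (Fin.cons (α := fun _ => Ty S) T₁ Δ i) := fun i => by
      refine Fin.cases ?_ (fun j => ?_) i <;> simp [hT, hΔ]
    refine .lam hT (he.subst _ hΔ' fun i => ?_)
    refine Fin.cases ?_ (fun j => ?_) i
    · exact .var hΔ' 0
    · simpa using (hσ j).rename Fin.succ hΔ' fun i => by simp
  | .app h₁ h₂ => exact .app (h₁.subst σ hΔ hσ) (h₂.subst σ hΔ hσ)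
  | .op _ h => exact .op hΔ fun i => (h i).subst σ hΔ hσ
  | .cast h₁ h₂ hc he hsrc => exact .cast h₁ h₂ hc (he.subst σ hΔ hσ) hsrc
  | .coercion hc he => exact .coercion hc (he.subst σ hΔ hσ)
  | .blame _ hT => exact .blame hΔ hT
  | .check _ hT hk he hred => exact .check hΔ hT hk he hred
  | .stack _ hT hk hB hr hn hsh he hp hc => exact .stack hΔ hT hk hB hr hn hsh he hp hc

theorem Typed.inst {m : Mode} {src : Bool} {Γ : Fin 1 → Ty S} {Δ : Fin 0 → Ty S} {e : Term S 1}
    {v : Term S 0} {T : Ty S} (h : Typed O imp m src Γ e T)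
    (hv : Typed O imp m src Δ v (Γ 0)) : Typed O imp m src Δ (e.inst v) T :=
  h.subst _ (fun i => i.elim0) fun i => by rwa [Subsingleton.elim i 0]

/-- The predicate of a well-formed refinement, instantiated with a constant, is a Boolean. -/
theorem WfTy.inst_const {m : Mode} {B : S.Base} {e : Term S 1} {k : S.Const}
    (h : WfTy O imp m false (.refine B e)) (hk : S.tyConst k = B) :
    Typed O imp m false Fin.elim0 (e.inst (.const k)) (Ty.raw S.boolTy) := by
  have hraw : Typed O imp m false Fin.elim0 (.const k) (Ty.raw B) :=
    .const (fun i => i.elim0) hk (.base B) .refl (fun h => nomatch h)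
  generalize hT : Ty.refine B e = T at h
  cases h with
  | base B' =>
    cases hT
    exact .const (fun i => i.elim0) ((S.tyConst_bool_iff _).2 (.inl rfl)) (.base _) .refl
      (fun h => nomatch h)
  | refine h => cases hT; exact h.inst hraw
  | arrow => cases hT

theorem Typed.const_inv {m : Mode} {n : ℕ} {Γ : Fin n → Ty S} {k : S.Const} {T : Ty S}
    (h : Typed O imp m false Γ (.const k) T) : ∃ e, T = .refine (S.tyConst k) e ∧
      WfTy O imp m false T ∧ Steps O imp m (e.inst (.const k)) (.const S.tt) := by
  cases h with
  | const hΓ hk hT he => subst hk; exact ⟨_, rfl, hT, he⟩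

/-! ### Merging coercions -/

theorem RList.drop_cons_of_imp {B B₁ : S.Base} {e e₁ : Term S 1} (h : B₁ = B ∧ imp B e e₁)
    (l : Label S) (r : RList S) : (cons B₁ e₁ l r).drop imp B e = r.drop imp B e := by
  rw [RList.drop, if_pos h]

theorem RList.drop_cons_of_not_imp {B B₁ : S.Base} {e e₁ : Term S 1}
    (h : ¬(B₁ = B ∧ imp B e e₁)) (l : Label S) (r : RList S) :
    (cons B₁ e₁ l r).drop imp B e = .cons B₁ e₁ l (r.drop imp B e) := by
  rw [RList.drop, if_neg h]

theorem RList.mem_types_drop {B : S.Base} {e : Term S 1} {p : S.Base × Term S 1} :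
    ∀ {r : RList S},
      p ∈ (r.drop imp B e).types ↔ p ∈ r.types ∧ ¬(p.1 = B ∧ imp B e p.2)
  | .nil => by simp [RList.drop, RList.types]
  | .cons B₁ e₁ l r => by
    by_cases h : B₁ = B ∧ imp B e e₁
    · rw [RList.drop, if_pos h, RList.mem_types_drop]
      simp only [RList.types, List.mem_cons]
      constructor
      · rintro ⟨h₁, h₂⟩; exact ⟨.inr h₁, h₂⟩
      · rintro ⟨rfl | h₁, h₂⟩
        · exact absurd h h₂
        · exact ⟨h₁, h₂⟩
    · rw [RList.drop, if_neg h]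
      simp only [RList.types, List.mem_cons, RList.mem_types_drop]
      constructor
      · rintro (rfl | ⟨h₁, h₂⟩)
        · exact ⟨.inl rfl, h⟩
        · exact ⟨.inr h₁, h₂⟩
      · rintro ⟨rfl | h₁, h₂⟩
        · exact .inl rfl
        · exact .inr ⟨h₁, h₂⟩

theorem RList.nodup_types_drop {B : S.Base} {e : Term S 1} :
    ∀ {r : RList S}, r.types.Nodup → (r.drop imp B e).types.Nodup
  | .nil, h => h
  | .cons B₁ e₁ l r, h => by
    rw [RList.types, List.nodup_cons] at h
    rw [RList.drop]
    split
    · exact nodup_types_drop h.2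
    · rw [RList.types, List.nodup_cons]
      exact ⟨fun h' => h.1 (mem_types_drop.1 h').1, nodup_types_drop h.2⟩

theorem RList.mem_types_merge {p : S.Base × Term S 1} {r₂ : RList S} :
    ∀ {r₁ : RList S}, p ∈ (r₁.merge imp r₂).types → p ∈ r₁.types ∨ p ∈ r₂.types
  | .nil, h => .inr h
  | .cons B e l r, h => by
    rw [RList.merge, RList.types, List.mem_cons] at h
    rw [RList.types, List.mem_cons, or_assoc]
    exact h.imp_right fun h => mem_types_merge (mem_types_drop.1 h).1

theorem RList.nodup_types_merge {r₂ : RList S} (h₂ : r₂.types.Nodup) :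
    ∀ {r₁ : RList S}, (∀ p ∈ r₁.types, imp p.1 p.2 p.2) → (r₁.merge imp r₂).types.Nodup
  | .nil, _ => h₂
  | .cons B e l r, h => by
    rw [RList.merge, RList.types, List.nodup_cons, mem_types_drop]
    rw [RList.types] at h
    exact ⟨fun h' => h'.2 ⟨rfl, h (B, e) (by simp)⟩,
      nodup_types_drop (nodup_types_merge h₂ fun p hp => h p (by simp [hp]))⟩

/-- Merging only deletes a type when an implying one is kept, so a merged list still has a type
that implies the target of the second list. -/
theorem RList.exists_imp_merge (himp : ImplicationLaws O imp) {B : S.Base} {e : Term S 1}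
    {r₂ : RList S} (h₂ : ∃ e', (B, e') ∈ r₂.types ∧ imp B e' e) :
    ∀ {r₁ : RList S}, ∃ e', (B, e') ∈ (r₁.merge imp r₂).types ∧ imp B e' e
  | .nil => h₂
  | .cons B₁ e₁ l r => by
    obtain ⟨e', he', hi⟩ := exists_imp_merge himp h₂ (r₁ := r)
    rw [RList.merge, RList.types]
    by_cases h : B = B₁ ∧ imp B₁ e₁ e'
    · obtain ⟨rfl, h⟩ := h
      exact ⟨e₁, by simp, himp.trans _ _ _ _ h hi⟩
    · exact ⟨e', List.mem_cons_of_mem _ (mem_types_drop.2 ⟨he', h⟩), hi⟩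

theorem RList.drop_comm {B B' : S.Base} {e e' : Term S 1} : ∀ r : RList S,
    (r.drop imp B e).drop imp B' e' = (r.drop imp B' e').drop imp B e
  | .nil => rfl
  | .cons B₁ e₁ l r => by
    have ih := drop_comm (B := B) (B' := B') (e := e) (e' := e') r
    by_cases h : B₁ = B ∧ imp B e e₁ <;> by_cases h' : B₁ = B' ∧ imp B' e' e₁
    · rw [drop_cons_of_imp h, drop_cons_of_imp h', ih]
    · rw [drop_cons_of_imp h, drop_cons_of_not_imp h', drop_cons_of_imp h, ih]
    · rw [drop_cons_of_not_imp h, drop_cons_of_imp h', drop_cons_of_imp h', ih]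
    · rw [drop_cons_of_not_imp h, drop_cons_of_not_imp h', drop_cons_of_not_imp h',
        drop_cons_of_not_imp h, ih]

theorem RList.drop_drop_of_imp (himp : ImplicationLaws O imp) {B : S.Base} {e e' : Term S 1}
    (h : imp B e e') : ∀ r : RList S, (r.drop imp B e').drop imp B e = r.drop imp B e
  | .nil => rfl
  | .cons B₁ e₁ l r => by
    have ih := drop_drop_of_imp himp h r
    by_cases h₁ : B₁ = B ∧ imp B e' e₁
    · have h₂ : B₁ = B ∧ imp B e e₁ := ⟨h₁.1, himp.trans _ _ _ _ h h₁.2⟩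
      rw [drop_cons_of_imp h₁, drop_cons_of_imp h₂, ih]
    · rw [drop_cons_of_not_imp h₁]
      by_cases h₂ : B₁ = B ∧ imp B e e₁
      · rw [drop_cons_of_imp h₂, drop_cons_of_imp h₂, ih]
      · rw [drop_cons_of_not_imp h₂, drop_cons_of_not_imp h₂, ih]

/-- What `e` implies need not be kept in `r₁` when it is dropped after merging: a type that is
dropped because of a type implied by `e` is itself implied by `e`. -/
theorem RList.drop_merge_drop (himp : ImplicationLaws O imp) {B : S.Base} {e : Term S 1}
    (r₂ : RList S) : ∀ r₁ : RList S,
    ((r₁.drop imp B e).merge imp r₂).drop imp B e = (r₁.merge imp r₂).drop imp B e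
  | .nil => rfl
  | .cons B₁ e₁ l r => by
    have ih := drop_merge_drop himp r₂ r (B := B) (e := e)
    by_cases h : B₁ = B ∧ imp B e e₁
    · obtain ⟨rfl, h⟩ := h
      rw [RList.drop, if_pos ⟨rfl, h⟩, RList.merge, RList.drop, if_pos ⟨rfl, h⟩, ih,
        drop_drop_of_imp himp h]
    · rw [RList.drop, if_neg h, RList.merge, RList.merge, RList.drop, RList.drop, if_neg h,
        if_neg h, drop_comm, ih, drop_comm]

theorem RList.merge_assoc (himp : ImplicationLaws O imp) (r₂ r₃ : RList S) : ∀ r₁ : RList S,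
    (r₁.merge imp r₂).merge imp r₃ = r₁.merge imp (r₂.merge imp r₃)
  | .nil => rfl
  | .cons B e l r => by
    rw [RList.merge, RList.merge, RList.merge, drop_merge_drop himp, merge_assoc himp]

theorem Coercion.merge_fn_eq_some {c₁₁ c₁₂ c₂₁ c₂₂ c : Coercion S} :
    (Coercion.fn c₁₁ c₁₂).merge imp (.fn c₂₁ c₂₂) = some c ↔
      ∃ d d', c₂₁.merge imp c₁₁ = some d ∧ c₁₂.merge imp c₂₂ = some d' ∧ c = .fn d d' := by
  rw [Coercion.merge]
  simp only [Option.bind_eq_some_iff, Option.some.injEq]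
  constructor
  · rintro ⟨d, h, d', h', rfl⟩; exact ⟨d, d', h, h', rfl⟩
  · rintro ⟨d, d', h, h', rfl⟩; exact ⟨d, h, d', h', rfl⟩

/-- Merging is associative because `⊃` is transitive. The induction is on the middle coercion, as
the domain components of function coercions are merged in the opposite order. -/
theorem Coercion.merge_assoc (himp : ImplicationLaws O imp) : ∀ c₂ : Coercion S,
    ∀ {c₁ c₃ c₁₂ c₂₃ : Coercion S}, c₁.merge imp c₂ = some c₁₂ → c₂.merge imp c₃ = some c₂₃ →
      c₁₂.merge imp c₃ = c₁.merge imp c₂₃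
  | .refs r₂, .refs r₁, .refs r₃, _, _, h, h' => by
    rw [Coercion.merge, Option.some.injEq] at h h'
    subst h h'
    rw [Coercion.merge, Coercion.merge, RList.merge_assoc himp]
  | .refs r₂, .fn _ _, _, _, _, h, _ => by simp [Coercion.merge] at h
  | .refs r₂, _, .fn _ _, _, _, _, h => by simp [Coercion.merge] at h
  | .fn _ _, .refs _, _, _, _, h, _ => by simp [Coercion.merge] at h
  | .fn _ _, _, .refs _, _, _, _, h => by simp [Coercion.merge] at h
  | .fn c₂₁ c₂₂, .fn c₁₁ c₁₂, .fn c₃₁ c₃₂, _, _, h, h' => by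
    obtain ⟨d, d', hd, hd', rfl⟩ := Coercion.merge_fn_eq_some.1 h
    obtain ⟨f, f', hf, hf', rfl⟩ := Coercion.merge_fn_eq_some.1 h'
    rw [Coercion.merge, Coercion.merge, Coercion.merge_assoc himp c₂₁ hf hd,
      Coercion.merge_assoc himp c₂₂ hd' hf']

theorem WfCoercion.refs_inv {r : RList S} {T₁ T₂ : Ty S}
    (h : WfCoercion O imp (.refs r) T₁ T₂) : ∃ B e₁ e₂, T₁ = .refine B e₁ ∧ T₂ = .refine B e₂ ∧
      (∀ p ∈ r.types, p.1 = B) ∧ ∃ e, (B, e) ∈ r.types ∧ imp B e e₂ := by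
  cases h with
  | refs h₁ h₂ hB hr hn hi => exact ⟨_, _, _, rfl, rfl, hB, hi⟩

/-- Well-formed coercions with a common middle type can be merged. The induction is on that type,
as the domain components of function coercions are merged in the opposite order. -/
theorem WfCoercion.merge (himp : ImplicationLaws O imp) : ∀ {T₂ T₁ T₃ : Ty S}
    {c₁ c₂ : Coercion S}, WfCoercion O imp c₁ T₁ T₂ → WfCoercion O imp c₂ T₂ T₃ →
      ∃ c, c₁.merge imp c₂ = some c ∧ WfCoercion O imp c T₁ T₃
  | .refine B e, T₁, T₃, c₁, c₂, h₁, h₂ => by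
    cases h₁ with
    | refs hw₁ hw₂ hB hr hn hi =>
      cases h₂ with
      | refs hw₁' hw₂' hB' hr' hn' hi' =>
        refine ⟨_, by rw [Coercion.merge], .refs hw₁ hw₂' (fun p hp => ?_) (fun p hp => ?_) ?_ ?_⟩
        · exact (RList.mem_types_merge hp).elim (hB p) (hB' p)
        · exact (RList.mem_types_merge hp).elim (hr p) (hr' p)
        · exact RList.nodup_types_merge hn' fun p hp => himp.refl _ _ (hr p hp)
        · exact RList.exists_imp_merge himp hi'
  | .arrow T₂₁ T₂₂, T₁, T₃, c₁, c₂, h₁, h₂ => by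
    cases h₁ with
    | fn h₁₁ h₁₂ =>
      cases h₂ with
      | fn h₂₁ h₂₂ =>
        obtain ⟨d, hd, hwd⟩ := WfCoercion.merge himp h₂₁ h₁₁
        obtain ⟨d', hd', hwd'⟩ := WfCoercion.merge himp h₁₂ h₂₂
        exact ⟨_, Coercion.merge_fn_eq_some.2 ⟨d, d', hd, hd', rfl⟩, .fn hwd hwd'⟩

theorem coerce_refine (l : Label S) (B : S.Base) (e₁ e₂ : Term S 1) :
    coerce l (.refine B e₁) (.refine B e₂) = some (.refs (.cons B e₂ l .nil)) := by
  rw [coerce, if_pos rfl]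

theorem coerce_arrow {l : Label S} {T₁₁ T₁₂ T₂₁ T₂₂ : Ty S} {d c : Coercion S}
    (hd : coerce l T₂₁ T₁₁ = some d) (hc : coerce l T₁₂ T₂₂ = some c) :
    coerce l (.arrow T₁₁ T₁₂) (.arrow T₂₁ T₂₂) = some (.fn d c) := by
  rw [coerce, hd, hc]; rfl

theorem WfCoercion.coerce (himp : ImplicationLaws O imp) (l : Label S) : ∀ {T₁ T₂ : Ty S},
    Compat T₁ T₂ → WfTy O imp .E false T₁ → WfTy O imp .E false T₂ →
      ∃ c, LambdaH.coerce l T₁ T₂ = some c ∧ WfCoercion O imp c T₁ T₂ := by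
  -- Both directions are proved together since domains are coerced contravariantly.
  suffices H : ∀ {T₁ T₂ : Ty S}, Compat T₁ T₂ → WfTy O imp .E false T₁ →
      WfTy O imp .E false T₂ →
      (∃ c, LambdaH.coerce l T₁ T₂ = some c ∧ WfCoercion O imp c T₁ T₂) ∧
      (∃ c, LambdaH.coerce l T₂ T₁ = some c ∧ WfCoercion O imp c T₂ T₁) from
    fun {_ _} hc h₁ h₂ => (H hc h₁ h₂).1
  intro T₁ T₂ hc h₁ h₂
  induction hc with
  | refine B e₁ e₂ =>
    have key : ∀ {e₁ e₂ : Term S 1}, WfTy O imp .E false (.refine B e₁) →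
        WfTy O imp .E false (.refine B e₂) →
        WfCoercion O imp (.refs (.cons B e₂ l .nil)) (.refine B e₁) (.refine B e₂) :=
      fun h₁ h₂ => .refs h₁ h₂ (by simp [RList.types]) (by simpa [RList.types] using h₂)
        (by simp [RList.types]) ⟨_, by simp [RList.types], himp.refl _ _ h₂⟩
    exact ⟨⟨_, coerce_refine _ _ _ _, key h₁ h₂⟩, ⟨_, coerce_refine _ _ _ _, key h₂ h₁⟩⟩
  | arrow _ _ ih₁ ih₂ =>
    obtain ⟨⟨c₁, hc₁, hw₁⟩, ⟨c₁', hc₁', hw₁'⟩⟩ := ih₁ h₁.arrow_inv.1 h₂.arrow_inv.1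
    obtain ⟨⟨c₂, hc₂, hw₂⟩, ⟨c₂', hc₂', hw₂'⟩⟩ := ih₂ h₁.arrow_inv.2 h₂.arrow_inv.2
    exact ⟨⟨_, coerce_arrow hc₁' hc₂, .fn hw₁' hw₂⟩, ⟨_, coerce_arrow hc₁ hc₂', .fn hw₁ hw₂'⟩⟩

/-! ### Eidetic reduction is deterministic -/

theorem Val.not_step {v e : Term S 0} (hv : Val .E v) : ¬Step O imp .E v e := by
  intro h
  cases hv with
  | const => cases h
  | lam => cases h
  | proxyE =>
    cases h with
    | castInnerE _ h => cases h

theorem not_step_blame {m : Mode} {l : Label S} {e : Term S 0} :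
    ¬Step O imp m (.blame l) e := by
  intro h; cases h

theorem Val.ne_blame {m : Mode} {l : Label S} : ¬Val m (.blame l : Term S 0) := by
  intro h; cases h

/-- The position of the next step of an operation application is unique. -/
theorem opPosition_unique {n : ℕ} {es : Fin n → Term S 0} {i j : Fin n}
    (hi : ∀ k, k < i → Val .E (es k)) (hj : ∀ k, k < j → Val .E (es k))
    (hi' : ¬Val .E (es i)) (hj' : ¬Val .E (es j)) : i = j := by
  rcases lt_trichotomy i j with h | h | h
  · exact absurd (hj i h) hi'
  · exact h
  · exact absurd (hi j h) hj'

theorem Step.deterministic {e e₁ e₂ : Term S 0} (h₁ : Step O imp .E e e₁)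
    (h₂ : Step O imp .E e e₂) : e₁ = e₂ := by
  generalize hm : Mode.E = m at h₁
  induction h₁ generalizing e₂ with
  | @beta m T e₁ e₂ h =>
    subst hm
    cases h₂ with
    | beta => rfl
    | appL h' => cases h'
    | appR _ h' => exact absurd h' h.not_step
    | appRaiseR => exact absurd h Val.ne_blame
  | @op m o ks k h =>
    subst hm
    generalize hes : (fun i => Term.const (ks i)) = es at h₂
    cases h₂ with
    | @op _ _ ks' k' h' =>
      have : ks = ks' := by
        funext i
        have := congrFun hes i
        simpa using this
      subst this
      rw [h] at h'
      cases h'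
      rfl
    | opInner i hv h' => subst hes; cases h'
    | opRaise i hv h' => subst hes; cases h'
  | unwrap h h' hd hc =>
    subst hm
    cases h₂ with
    | unwrap _ _ hd' hc' =>
      rw [hd] at hd'; rw [hc] at hc'; cases hd'; cases hc'; rfl
    | appL h₂ => exact absurd h₂ h.not_step
    | appR _ h₂ => exact absurd h₂ h'.not_step
    | appRaiseR => exact absurd h' Val.ne_blame
  | appL h ih =>
    subst hm
    cases h₂ with
    | beta => cases h
    | unwrap hv => exact absurd h hv.not_step
    | appL h' => rw [ih h' rfl]
    | appR hv => exact absurd h hv.not_step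
    | appRaiseL => cases h
    | appRaiseR hv => exact absurd h hv.not_step
  | appR hv h ih =>
    subst hm
    cases h₂ with
    | beta hv' => exact absurd h hv'.not_step
    | unwrap _ hv' => exact absurd h hv'.not_step
    | appL h' => exact absurd h' hv.not_step
    | appR _ h' => rw [ih h' rfl]
    | appRaiseL => exact absurd hv Val.ne_blame
    | appRaiseR => cases h
  | opInner i hv h ih =>
    subst hm
    cases h₂ with
    | op => cases h
    | opInner j hv' h' =>
      obtain rfl := opPosition_unique hv hv' (fun h₁ => h₁.not_step h) (fun h₁ => h₁.not_step h')
      rw [ih h' rfl]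
    | opRaise j hv' h' =>
      obtain rfl := opPosition_unique hv hv' (fun h₁ => h₁.not_step h)
        (fun h₁ => by rw [h'] at h₁; exact h₁.ne_blame)
      rw [h'] at h; cases h
  | appRaiseL =>
    subst hm
    cases h₂ with
    | appL h' => cases h'
    | appR hv => exact absurd hv Val.ne_blame
    | appRaiseL => rfl
    | appRaiseR hv => exact absurd hv Val.ne_blame
  | appRaiseR hv =>
    subst hm
    cases h₂ with
    | beta h => exact absurd h Val.ne_blame
    | unwrap _ h => exact absurd h Val.ne_blame
    | appL h' => exact absurd h' hv.not_step
    | appR _ h' => cases h'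
    | appRaiseL => exact absurd hv Val.ne_blame
    | appRaiseR => rfl
  | opRaise i hv h =>
    subst hm
    cases h₂ with
    | op => cases h
    | opInner j hv' h' =>
      obtain rfl := opPosition_unique hv hv' (fun h₁ => by rw [h] at h₁; exact h₁.ne_blame)
        (fun h₁ => h₁.not_step h')
      rw [h] at h'; cases h'
    | opRaise j hv' h' =>
      obtain rfl := opPosition_unique hv hv' (fun h₁ => by rw [h] at h₁; exact h₁.ne_blame)
        (fun h₁ => by rw [h'] at h₁; exact h₁.ne_blame)
      rw [h] at h'; cases h'; rfl
  | checkOK =>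
    generalize hk : S.tt = k at h₂
    cases h₂ with
    | checkOK => rfl
    | checkFail => exact absurd hk S.tt_ne_ff
    | checkInner h' => cases h'
  | checkFail =>
    generalize hk : S.ff = k at h₂
    cases h₂ with
    | checkOK => exact absurd hk.symm S.tt_ne_ff
    | checkFail => rfl
    | checkInner h' => cases h'
  | checkInner h ih =>
    subst hm
    cases h₂ with
    | checkOK => cases h
    | checkFail => cases h
    | checkInner h' => rw [ih h' rfl]
    | checkRaise => cases h
  | checkRaise =>
    cases h₂ with
    | checkInner h' => cases h'
    | checkRaise => rfl
  | checkNone => cases hm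
  | castInnerC => cases hm
  | castRaiseC => cases hm
  | coerce h =>
    cases h₂ with
    | coerce h' => rw [h] at h'; cases h'; rfl
  | castInnerE hne h ih =>
    cases h₂ with
    | castInnerE _ h' => rw [ih h' rfl]
    | castMerge => exact absurd rfl (hne _ _ _ _ _)
    | castRaiseE => cases h
    | coerceStack => cases h
  | castMerge h =>
    cases h₂ with
    | castInnerE hne => exact absurd rfl (hne _ _ _ _ _)
    | castMerge h' => rw [h] at h'; cases h'; rfl
  | castRaiseE =>
    cases h₂ with
    | castInnerE _ h' => cases h'
    | castRaiseE => rfl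
  | coerceStack =>
    cases h₂ with
    | castInnerE _ h' => cases h'
    | coerceStack => rfl
  | stackPop =>
    cases h₂ with
    | stackPop => rfl
    | stackInner h' => cases h'
  | stackInner h ih =>
    cases h₂ with
    | stackPop => cases h
    | stackInner h' => rw [ih h' rfl]
    | stackRaise => cases h
    | stackDone => cases h
  | stackRaise =>
    cases h₂ with
    | stackInner h' => cases h'
    | stackRaise => rfl
  | stackDone =>
    cases h₂ with
    | stackInner h' => cases h'
    | stackDone => rfl

/-! ### Outcomes of eidetic evaluation -/

/-- Final terms: values and blame. -/
def Final (R : Term S 0) : Prop := Val .E R ∨ ∃ l, R = .blame l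

theorem Final.not_step {R e : Term S 0} (h : Final R) : ¬Step O imp .E R e := by
  rcases h with h | ⟨l, rfl⟩
  · exact h.not_step
  · exact not_step_blame

theorem Final.const (k : S.Const) : Final (.const k) := .inl (.const k)

theorem Final.blame (l : Label S) : Final (.blame l) := .inr ⟨l, rfl⟩

/-- Eidetic evaluation: `e ⇓ R` when `e` reduces to the final term `R`. -/
def Evals (O : OpInterp S) (imp : Implication S) (e R : Term S 0) : Prop :=
  Steps O imp .E e R ∧ Final R

theorem Final.evals_self {R : Term S 0} (h : Final R) : Evals O imp R R := ⟨.refl, h⟩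

theorem Step.evals_iff {e e' R : Term S 0} (h : Step O imp .E e e') :
    Evals O imp e R ↔ Evals O imp e' R := by
  refine ⟨fun ⟨hs, hR⟩ => ⟨?_, hR⟩, fun ⟨hs, hR⟩ => ⟨.head h hs, hR⟩⟩
  rcases hs.cases_head with rfl | ⟨e'', h', hs⟩
  · exact absurd h hR.not_step
  · rwa [h.deterministic h']

theorem Steps.evals_iff {e e' R : Term S 0} (h : Steps O imp .E e e') :
    Evals O imp e R ↔ Evals O imp e' R := by
  induction h with
  | refl => rfl
  | tail _ h ih => rw [ih, h.evals_iff]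

theorem Final.evals_iff {e R : Term S 0} (h : Final e) : Evals O imp e R ↔ R = e := by
  refine ⟨fun ⟨hs, hR⟩ => ?_, fun hR => by subst hR; exact h.evals_self⟩
  rcases hs.cases_head with rfl | ⟨e'', h', hs⟩
  · rfl
  · exact absurd h' h.not_step

theorem Evals.evals_iff {e Q R : Term S 0} (h : Evals O imp e Q) : Evals O imp e R ↔ R = Q := by
  rw [Steps.evals_iff h.1, h.2.evals_iff]

theorem evals_const_iff {k : S.Const} {R : Term S 0} :
    Evals O imp (.const k) R ↔ R = .const k := (Final.const k).evals_iff

theorem evals_blame_iff {l : Label S} {R : Term S 0} :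
    Evals O imp (.blame l) R ↔ R = .blame l := (Final.blame l).evals_iff

theorem Steps.map {m : Mode} {F : Term S 0 → Term S 0}
    (hF : ∀ {e e'}, Step O imp m e e' → Step O imp m (F e) (F e')) {e e' : Term S 0}
    (h : Steps O imp m e e') : Steps O imp m (F e) (F e') :=
  Relation.ReflTransGen.lift F (fun _ _ h => hF h) _ _ h

/-- Evaluation of a term in an evaluation frame `F`: evaluate the term first. The predicate `P`
delimits the terms for which `F` is a frame, as a coercion is not one for another coercion. -/
theorem evals_frame_iff {F : Term S 0 → Term S 0} (P : Term S 0 → Prop)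
    (hP : ∀ {e e'}, P e → Step O imp .E e e' → P e')
    (hF : ∀ {e e'}, P e → Step O imp .E e e' → Step O imp .E (F e) (F e'))
    (hinv : ∀ {e X}, P e → Step O imp .E (F e) X → Final e ∨ ∃ e', Step O imp .E e e')
    (hfin : ∀ {e}, P e → Final (F e) → Final e) {e R : Term S 0} (he : P e) :
    Evals O imp (F e) R ↔ ∃ Q, Evals O imp e Q ∧ Evals O imp (F Q) R := by
  have hsteps : ∀ {e Q}, Steps O imp .E e Q → P e → Steps O imp .E (F e) (F Q) := by
    intro e Q h
    induction h using Relation.ReflTransGen.head_induction_on with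
    | refl => exact fun _ => .refl
    | head h _ ih => exact fun he => .head (hF he h) (ih (hP he h))
  constructor
  · rintro ⟨hs, hR⟩
    generalize hX : F e = X at hs
    induction hs using Relation.ReflTransGen.head_induction_on generalizing e with
    | refl =>
      subst hX
      exact ⟨e, (hfin he hR).evals_self, hR.evals_self⟩
    | head h hs ih =>
      subst hX
      rcases hinv he h with hf | ⟨e', h'⟩
      · exact ⟨e, hf.evals_self, .head h hs, hR⟩
      · obtain ⟨Q, hQ, hQR⟩ := ih (hP he h') ((hF he h').deterministic h)
        exact ⟨Q, h'.evals_iff.2 hQ, hQR⟩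
  · rintro ⟨Q, hQ, hQR⟩
    exact (Steps.evals_iff (hsteps hQ.1 he)).2 hQR

theorem evals_check_iff {B : S.Base} {e₁ : Term S 1} {e R : Term S 0} {k : S.Const}
    {l : Label S} : Evals O imp (.check B e₁ e k l) R ↔
      ∃ Q, Evals O imp e Q ∧ Evals O imp (.check B e₁ Q k l) R := by
  refine evals_frame_iff (F := fun e => .check B e₁ e k l) (fun _ => True) (fun _ _ => trivial)
    (fun _ h => .checkInner h) (fun _ h => ?_) (fun _ h => ?_) trivial
  · cases h with
    | checkOK => exact .inl (.const _)
    | checkFail => exact .inl (.const _)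
    | checkInner h => exact .inr ⟨_, h⟩
    | checkRaise => exact .inl (.blame _)
  · rcases h with h | ⟨l, h⟩ <;> cases h

theorem evals_stack_iff {B : S.Base} {e₁ : Term S 1} {s : Status} {r : RList S} {e R : Term S 0}
    {k : S.Const} : Evals O imp (.stack B e₁ s r k e) R ↔
      ∃ Q, Evals O imp e Q ∧ Evals O imp (.stack B e₁ s r k Q) R := by
  refine evals_frame_iff (F := fun e => .stack B e₁ s r k e) (fun _ => True) (fun _ _ => trivial)
    (fun _ h => .stackInner h) (fun _ h => ?_) (fun _ h => ?_) trivial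
  · cases h with
    | stackPop => exact .inl (.const _)
    | stackInner h => exact .inr ⟨_, h⟩
    | stackRaise => exact .inl (.blame _)
    | stackDone => exact .inl (.const _)
  · rcases h with h | ⟨l, h⟩ <;> cases h

theorem evals_app_iff {v e R : Term S 0} (hv : Val .E v) : Evals O imp (.app v e) R ↔
      ∃ Q, Evals O imp e Q ∧ Evals O imp (.app v Q) R := by
  refine evals_frame_iff (F := fun e => .app v e) (fun _ => True) (fun _ _ => trivial)
    (fun _ h => .appR hv h) (fun _ h => ?_) (fun _ h => ?_) trivial
  · cases h with
    | beta h => exact .inl (.inl h)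
    | unwrap _ h => exact .inl (.inl h)
    | appL h => exact absurd h hv.not_step
    | appR _ h => exact .inr ⟨_, h⟩
    | appRaiseL => exact absurd hv Val.ne_blame
    | appRaiseR => exact .inl (.blame _)
  · rcases h with h | ⟨l, h⟩ <;> cases h

theorem evals_app_blame_iff {v R : Term S 0} {l : Label S} (hv : Val .E v) :
    Evals O imp (.app v (.blame l)) R ↔ R = .blame l := by
  rw [(Step.appRaiseR hv).evals_iff, evals_blame_iff]

theorem evals_cast_blame_iff {T₁ T₂ : Ty S} {c : Coercion S} {R : Term S 0} {l l' : Label S} :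
    Evals O imp (.cast T₁ (.coe c) T₂ l (.blame l')) R ↔ R = .blame l' := by
  rw [Step.castRaiseE.evals_iff, evals_blame_iff]

/-! ### Evaluating refinement lists -/

theorem Evals.check_cases {B : S.Base} {e₁ : Term S 1} {e R : Term S 0} {k : S.Const}
    {l : Label S} (h : Evals O imp (.check B e₁ e k l) R) :
    (Steps O imp .E e (.const S.tt) ∧ R = .const k) ∨ ∃ l', R = .blame l' := by
  obtain ⟨Q, hQ, hs, hR⟩ := evals_check_iff.1 h
  rcases hs.cases_head with rfl | ⟨X, hX, hs⟩
  · rcases hR with h | ⟨l, h⟩ <;> cases h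
  · cases hX with
    | checkOK => exact .inl ⟨hQ.1, evals_const_iff.1 ⟨hs, hR⟩⟩
    | checkFail => exact .inr ⟨_, evals_blame_iff.1 ⟨hs, hR⟩⟩
    | checkInner h => exact absurd h hQ.2.not_step
    | checkRaise => exact .inr ⟨_, evals_blame_iff.1 ⟨hs, hR⟩⟩

theorem evals_check_const_iff {B : S.Base} {e₁ : Term S 1} {e : Term S 0} {k : S.Const}
    {l : Label S} : Evals O imp (.check B e₁ e k l) (.const k) ↔
      Steps O imp .E e (.const S.tt) := by
  refine ⟨fun h => ?_, fun h => evals_check_iff.2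
    ⟨_, ⟨h, .const _⟩, Step.checkOK.evals_iff.2 (Final.const k).evals_self⟩⟩
  rcases h.check_cases with h | ⟨l, h⟩
  · exact h.1
  · cases h

/-- `RList.Checks O imp k R r`: checking the constant `k` against the types in `r`, one after the
other, has the outcome `R`, which is `k` if all the checks succeed and blame if one of them raises
it. There is no outcome if a check that is reached has none. -/
def RList.Checks (O : OpInterp S) (imp : Implication S) (k : S.Const) (R : Term S 0) :
    RList S → Prop
  | .nil => R = .const k
  | .cons B e l r =>
      (Steps O imp .E (e.inst (.const k)) (.const S.tt) ∧ r.Checks O imp k R) ∨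
      ∃ l', Evals O imp (.check B e (e.inst (.const k)) k l) (.blame l') ∧ R = .blame l'

theorem RList.Checks.eq {k : S.Const} {R : Term S 0} : ∀ {r : RList S}, r.Checks O imp k R →
    R = .const k ∨ ∃ l, R = .blame l
  | .nil, h => .inl h
  | .cons _ _ _ _, .inl h => h.2.eq
  | .cons _ _ _ _, .inr ⟨l, h⟩ => .inr ⟨l, h.2⟩

/-- A stack whose target is covered, by its status or by a type still to be checked, evaluates as
its refinement list does. -/
theorem evals_stack_iff_checks {B : S.Base} {e₁ : Term S 1} {k : S.Const} {R : Term S 0} :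
    ∀ {r : RList S} {s : Status}, (∀ p ∈ r.types, p.1 = B) →
      (s = .checked ∨ ∃ e, (B, e) ∈ r.types ∧ (e = e₁ ∨ imp B e e₁)) →
      (Evals O imp (.stack B e₁ s r k (.const k)) R ↔ r.Checks O imp k R)
  | .nil, s, _, hs => by
    obtain rfl : s = .checked := by simpa [RList.types] using hs
    rw [Step.stackDone.evals_iff, evals_const_iff, RList.Checks]
  | .cons B' e l r, s, hB, hs => by
    obtain rfl : B' = B := hB (B', e) (by simp [RList.types])
    have hB' : ∀ p ∈ r.types, p.1 = B' := fun p hp => hB p (by simp [RList.types, hp])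
    have hs' : s.or (e = e₁ ∨ imp B' e e₁) = .checked ∨
        ∃ e, (B', e) ∈ r.types ∧ (e = e₁ ∨ imp B' e e₁) := by
      cases s with
      | checked => exact .inl rfl
      | pending =>
        by_cases h : e = e₁ ∨ imp B' e e₁
        · exact .inl (by simp [Status.or, h])
        · obtain ⟨e', he', hi⟩ := hs.resolve_left (fun h => nomatch h)
          simp only [RList.types, List.mem_cons, Prod.mk.injEq, true_and] at he'
          rcases he' with rfl | he'
          · exact absurd hi h
          · exact .inr ⟨e', he', hi⟩
    rw [Step.stackPop.evals_iff, evals_stack_iff, RList.Checks]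
    constructor
    · rintro ⟨Q, hQ, hR⟩
      rcases hQ.check_cases with ⟨htt, rfl⟩ | ⟨l', rfl⟩
      · exact .inl ⟨htt, (evals_stack_iff_checks hB' hs').1 hR⟩
      · rw [Step.stackRaise.evals_iff, evals_blame_iff] at hR
        exact .inr ⟨l', hQ, hR⟩
    · rintro (⟨htt, hR⟩ | ⟨l', hQ, rfl⟩)
      · exact ⟨_, evals_check_const_iff.2 htt, (evals_stack_iff_checks hB' hs').2 hR⟩
      · exact ⟨_, hQ, Step.stackRaise.evals_iff.2 (Final.blame l').evals_self⟩

/-- By adequacy, dropping the types implied by one that `k` satisfies does not matter. -/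
theorem RList.checks_drop_iff (himp : ImplicationLaws O imp) {B : S.Base} {e : Term S 1}
    {k : S.Const} {R : Term S 0} (hk : S.tyConst k = B)
    (he : Steps O imp .E (e.inst (.const k)) (.const S.tt)) : ∀ {r : RList S},
    (r.drop imp B e).Checks O imp k R ↔ r.Checks O imp k R
  | .nil => Iff.rfl
  | .cons B₁ e₁ l r => by
    have ih := checks_drop_iff himp hk he (r := r) (R := R)
    by_cases h : B₁ = B ∧ imp B e e₁
    · have he₁ := himp.adequate _ _ _ h.2 k hk he
      rw [drop_cons_of_imp h, ih, RList.Checks]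
      refine ⟨fun h => .inl ⟨he₁, h⟩, fun h => ?_⟩
      rcases h with h | ⟨l', h', -⟩
      · exact h.2
      · have := (evals_check_const_iff.2 he₁).evals_iff.1 h'
        cases this
    · rw [drop_cons_of_not_imp h, RList.Checks, RList.Checks, ih]

/-- Checking against a merged list is checking against the first list and, if that succeeds, against
the second one. -/
theorem RList.checks_merge_iff (himp : ImplicationLaws O imp) {k : S.Const} {R : Term S 0}
    {r₂ : RList S} : ∀ {r₁ : RList S}, (∀ p ∈ r₁.types, p.1 = S.tyConst k) →
    ((r₁.merge imp r₂).Checks O imp k R ↔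
      (r₁.Checks O imp k (.const k) ∧ r₂.Checks O imp k R) ∨
        ∃ l, R = .blame l ∧ r₁.Checks O imp k (.blame l))
  | .nil, _ => by simp [RList.merge, RList.Checks]
  | .cons B e l r, hB => by
    obtain rfl : B = S.tyConst k := hB (B, e) (by simp [RList.types])
    have ih := checks_merge_iff himp (R := R) (r₂ := r₂) (r₁ := r)
      fun p hp => hB p (by simp [RList.types, hp])
    rw [RList.merge, RList.Checks, RList.Checks]
    constructor
    · rintro (⟨htt, h⟩ | ⟨l', h, rfl⟩)
      · rw [RList.checks_drop_iff himp rfl htt, ih] at h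
        rcases h with ⟨h₁, h₂⟩ | ⟨l', rfl, h⟩
        · exact .inl ⟨.inl ⟨htt, h₁⟩, h₂⟩
        · exact .inr ⟨l', rfl, .inl ⟨htt, h⟩⟩
      · exact .inr ⟨l', rfl, .inr ⟨l', h, rfl⟩⟩
    · rintro (⟨⟨htt, h₁⟩ | ⟨l', h, h'⟩, h₂⟩ | ⟨l', rfl, ⟨htt, h⟩ | ⟨l'', h, h'⟩⟩)
      · exact .inl ⟨htt, (RList.checks_drop_iff himp rfl htt).2 (ih.2 (.inl ⟨h₁, h₂⟩))⟩
      · cases h'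
      · exact .inl ⟨htt, (RList.checks_drop_iff himp rfl htt).2 (ih.2 (.inr ⟨l', rfl, h⟩))⟩
      · exact .inr ⟨l'', h, h'⟩

/-! ### Eidetic preservation -/

/-- The side condition for typing a checked stack ensures, by adequacy of `⊃`, that the target
predicate holds of the constant when the current check has succeeded. -/
theorem steps_tt_of_checked (himp : ImplicationLaws O imp) {B : S.Base} {e₁ : Term S 1}
    {k : S.Const} (hk : S.tyConst k = B)
    (h : Steps O imp .E (e₁.inst (.const k)) (.const S.tt) ∨
      ∃ e l, imp B e e₁ ∧ Steps O imp .E (.check B e (e.inst (.const k)) k l) (.const k)) :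
    Steps O imp .E (e₁.inst (.const k)) (.const S.tt) := by
  rcases h with h | ⟨e, l, hi, h⟩
  · exact h
  · exact himp.adequate _ _ _ hi k hk (evals_check_const_iff.1 ⟨h, .const k⟩)

/-- Preservation for the eidetic semantics. -/
theorem Typed.step (hO : O.Lawful imp) (himp : ImplicationLaws O imp) {e e' : Term S 0} {T : Ty S}
    (ht : Typed O imp .E false Fin.elim0 e T) (h : Step O imp .E e e') :
    Typed O imp .E false Fin.elim0 e' T := by
  have hΓ : ∀ {m}, ∀ i : Fin 0, WfTy O imp m false ((Fin.elim0 : Fin 0 → Ty S) i) :=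
    fun i => i.elim0
  generalize hm : Mode.E = m at ht h ⊢
  induction h generalizing T with
  | beta h =>
    cases ht with
    | app h₁ h₂ =>
      cases h₁ with
      | lam hT he => exact he.inst h₂
  | @op m o ks k h =>
    subst hm
    cases ht with
    | op _ hks =>
      have hks' : ∀ i, S.tyConst (ks i) = O.argBase o i := fun i => by
        obtain ⟨e, he, -⟩ := (hks i).const_inv
        exact (Ty.refine.inj he).1.symm
      obtain ⟨hk, hres⟩ := hO.res_ok .E o ks k hks' h
      exact .const hΓ hk (hO.wf_res _ _) hres (fun h => nomatch h)
  | unwrap h h' hd hc =>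
    subst hm
    cases h with
    | proxyE =>
      cases hd
      cases hc
      cases ht with
      | app h₁ h₂ =>
        cases h₁ with
        | coercion hco he =>
          cases hco with
          | fn hc₁ hc₂ => exact .coercion hc₂ (.app he (.coercion hc₁ h₂))
  | appL h ih =>
    cases ht with
    | app h₁ h₂ => exact .app (ih hm h₁) h₂
  | appR hv h ih =>
    cases ht with
    | app h₁ h₂ => exact .app h₁ (ih hm h₂)
  | @opInner m o es i e' hv h ih =>
    cases ht with
    | op _ hes =>
      refine .op hΓ fun j => ?_
      by_cases hj : j = i
      · subst hj; simpa using ih hm (hes j)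
      · simpa [hj] using hes j
  | appRaiseL => exact .blame hΓ (ht.wf hO)
  | appRaiseR hv => exact .blame hΓ (ht.wf hO)
  | opRaise i hv h => exact .blame hΓ (ht.wf hO)
  | checkOK =>
    subst hm
    cases ht with
    | check _ hT hk he hred => exact .const hΓ hk hT hred (fun h => nomatch h)
  | checkFail => exact .blame hΓ (ht.wf hO)
  | checkInner h ih =>
    subst hm
    cases ht with
    | check _ hT hk he hred => exact .check hΓ hT hk (ih rfl he) (hred.tail h)
  | checkRaise => exact .blame hΓ (ht.wf hO)
  | checkNone => cases hm
  | castInnerC => cases hm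
  | castRaiseC => cases hm
  | @coerce T₁ T₂ l e c h =>
    cases ht with
    | cast h₁ h₂ hc he =>
      obtain ⟨c', hc', hw⟩ := WfCoercion.coerce himp l hc h₁ h₂
      rw [h] at hc'
      cases hc'
      exact .coercion hw he
  | castInnerE hne h ih =>
    cases ht with
    | coercion hc he => exact .coercion hc (ih hm he)
  | castMerge h =>
    cases ht with
    | coercion hc he =>
      cases he with
      | coercion hc' he =>
        obtain ⟨c, hm', hw⟩ := hc'.merge himp hc
        rw [h] at hm'
        cases hm'
        exact .coercion hw he
  | castRaiseE => exact .blame hΓ (ht.wf hO)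
  | coerceStack =>
    cases ht with
    | coercion hc he =>
      cases hc with
      | refs h₁ h₂ hB hr hn hi =>
        obtain ⟨e, he', -⟩ := he.const_inv
        cases he'
        exact .stack hΓ h₂ rfl hB hr hn (.inl rfl) he (fun _ => hi) (fun h => nomatch h)
  | @stackPop B e e' s l r k =>
    cases ht with
    | stack _ hT hk hB hr hn hsh he hp hc =>
      have hT' : WfTy O imp .E false (.refine B e') := hr (B, e') (by simp [RList.types])
      rw [RList.types, List.nodup_cons] at hn
      refine .stack hΓ hT hk (fun p hp => hB p (by simp [RList.types, hp]))
        (fun p hp => hr p (by simp [RList.types, hp])) hn.2 (.inr (.inl ⟨_, _, _, rfl⟩))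
        (.check hΓ hT' hk (hT'.inst_const hk) .refl) (fun h => ?_) (fun h => ?_)
      · cases s with
        | checked => cases h
        | pending =>
          have hne : ¬(e' = e ∨ imp B e' e) := fun h' => by simp [Status.or, h'] at h
          obtain ⟨e'', he'', hi⟩ := hp rfl
          simp only [RList.types, List.mem_cons, Prod.mk.injEq, true_and] at he''
          rcases he'' with rfl | he''
          · exact absurd (.inr hi) hne
          · exact ⟨e'', he'', hi⟩
      · cases s with
        | checked => exact .inl (steps_tt_of_checked himp hk (hc rfl))
        | pending =>
          by_cases h' : e' = e ∨ imp B e' e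
          · refine .inr ⟨e', l, ?_, .refl⟩
            rcases h' with rfl | h'
            · exact himp.refl _ _ hT
            · exact h'
          · simp [Status.or, h'] at h
  | @stackInner B e₁ s r k e e' h ih =>
    cases ht with
    | stack _ hT hk hB hr hn hsh he hp hc =>
      refine .stack hΓ hT hk hB hr hn ?_ (ih hm he) hp
        (fun hs => (hc hs).imp_right fun ⟨e, l, hi, hst⟩ => ⟨e, l, hi, hst.tail h⟩)
      rcases hsh with rfl | ⟨_, _, _, rfl⟩ | ⟨_, rfl⟩
      · cases h
      · cases h with
        | checkOK => exact .inl rfl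
        | checkFail => exact .inr (.inr ⟨_, rfl⟩)
        | checkInner h => exact .inr (.inl ⟨_, _, _, rfl⟩)
        | checkRaise => exact .inr (.inr ⟨_, rfl⟩)
      · cases h
  | stackRaise => exact .blame hΓ (ht.wf hO)
  | stackDone =>
    cases ht with
    | stack _ hT hk hB hr hn hsh he hp hc =>
      exact .const hΓ hk hT (steps_tt_of_checked himp hk (hc rfl)) (fun h => nomatch h)

theorem Typed.steps (hO : O.Lawful imp) (himp : ImplicationLaws O imp) {e e' : Term S 0}
    {T : Ty S} (ht : Typed O imp .E false Fin.elim0 e T) (h : Steps O imp .E e e') :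
    Typed O imp .E false Fin.elim0 e' T := by
  induction h with
  | refl => exact ht
  | tail _ h ih => exact ih.step hO himp h

/-! ### Coercions act on values -/

theorem Term.isCoercion_or (e : Term S 0) : (∃ T c T' l e', e = .cast T (.coe c) T' l e') ∨
    ∀ T T' c l e', e ≠ .cast T (.coe c) T' l e' := by
  by_cases h : ∃ T c T' l e', e = Term.cast T (.coe c) T' l e'
  · exact .inl h
  · exact .inr fun T T' c l e' he => h ⟨T, c, T', l, e', he⟩

theorem evals_coercion_const_iff {B : S.Base} {e₁ e₂ : Term S 1} {r : RList S} {k : S.Const}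
    {R : Term S 0} {l : Label S}
    (hw : WfCoercion O imp (.refs r) (.refine B e₁) (.refine B e₂)) :
    Evals O imp (.cast (.refine B e₁) (.coe (.refs r)) (.refine B e₂) l (.const k)) R ↔
      r.Checks O imp k R := by
  cases hw with
  | refs _ _ hB _ _ hi =>
    obtain ⟨e, he, hi⟩ := hi
    rw [Step.coerceStack.evals_iff, evals_stack_iff_checks hB (.inr ⟨e, he, .inr hi⟩)]

/-- A coercion around a stack runs the stack first. -/
theorem evals_coercion_stack_iff {T₁ T₂ : Ty S} {c : Coercion S} {B : S.Base} {e₁ : Term S 1}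
    {s : Status} {r : RList S} {k : S.Const} {e R : Term S 0} {l : Label S} :
    Evals O imp (.cast T₁ (.coe c) T₂ l (.stack B e₁ s r k e)) R ↔
      ∃ Q, Evals O imp (.stack B e₁ s r k e) Q ∧
        Evals O imp (.cast T₁ (.coe c) T₂ l Q) R := by
  have hne : ∀ {e : Term S 0}, ((∃ s r e', e = .stack B e₁ s r k e') ∨
      (∃ k, e = .const k) ∨ ∃ l, e = .blame l) →
      ∀ T T' c l e', e ≠ .cast T (.coe c) T' l e' := by
    rintro e (⟨_, _, _, rfl⟩ | ⟨_, rfl⟩ | ⟨_, rfl⟩) <;> simp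
  refine evals_frame_iff (F := fun e => .cast T₁ (.coe c) T₂ l e)
    (fun e => (∃ s r e', e = .stack B e₁ s r k e') ∨ (∃ k, e = .const k) ∨ ∃ l, e = .blame l)
    (fun h hst => ?_) (fun h hst => .castInnerE (fun _ _ _ _ _ => hne h _ _ _ _ _) hst)
    (fun h hst => ?_) (fun h hf => ?_) (.inl ⟨_, _, _, rfl⟩)
  · rcases h with ⟨_, _, _, rfl⟩ | ⟨_, rfl⟩ | ⟨_, rfl⟩
    · cases hst with
      | stackPop => exact .inl ⟨_, _, _, rfl⟩
      | stackInner => exact .inl ⟨_, _, _, rfl⟩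
      | stackRaise => exact .inr (.inr ⟨_, rfl⟩)
      | stackDone => exact .inr (.inl ⟨_, rfl⟩)
    · cases hst
    · cases hst
  · cases hst with
    | castInnerE _ h => exact .inr ⟨_, h⟩
    | castMerge => exact absurd rfl (hne h _ _ _ _ _)
    | castRaiseE => exact .inl (.blame _)
    | coerceStack => exact .inl (.const _)
  · rcases hf with hf | ⟨l, hf⟩
    · cases hf with
      | proxyE => exact .inl (.lam _ _)
    · cases hf

/-- Reducing the body of a coercion does not change its outcome, even though coercions on top of
each other merge before the inner one acts. -/
theorem Step.evals_coercion_iff (himp : ImplicationLaws O imp) {T₁ T₂ : Ty S} {c : Coercion S}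
    {e e' R : Term S 0} (ht : Typed O imp .E false Fin.elim0 e T₁)
    (hc : WfCoercion O imp c T₁ T₂) (h : Step O imp .E e e') :
    Evals O imp (.cast T₁ (.coe c) T₂ none e) R ↔
      Evals O imp (.cast T₁ (.coe c) T₂ none e') R := by
  rcases e.isCoercion_or with ⟨T, c', T', l, e₀, rfl⟩ | hne
  · cases ht with
    | coercion hc' ht =>
      obtain ⟨d, hd, hwd⟩ := hc'.merge himp hc
      rw [(Step.castMerge hd).evals_iff]
      cases h with
      | castInnerE hne h =>
        rw [(Step.castMerge hd).evals_iff, (Step.castInnerE hne h).evals_iff]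
      | castMerge h' =>
        cases ht with
        | coercion hc'' ht =>
          obtain ⟨f, hf, hwf⟩ := hc''.merge himp hwd
          have hf' := Coercion.merge_assoc himp _ h' hd
          rw [hf] at hf'
          rw [(Step.castMerge hf).evals_iff, (Step.castMerge hf').evals_iff]
      | castRaiseE => rw [evals_cast_blame_iff, evals_cast_blame_iff]
      | @coerceStack B e₁ e₂ r k =>
        cases c with
        | fn => cases hc
        | refs r₂ =>
          obtain ⟨B', _, e₃, h₁, rfl, -, -⟩ := hc.refs_inv
          cases h₁
          rw [Coercion.merge, Option.some.injEq] at hd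
          subst hd
          obtain ⟨_, hB, -⟩ := ht.const_inv
          cases hB
          have hB := hc'.refs_inv
          obtain ⟨_, _, _, h₁, h₂, hB, hi⟩ := hB
          cases h₁; cases h₂
          obtain ⟨e, he, hi⟩ := hi
          rw [evals_coercion_const_iff hwd, RList.checks_merge_iff himp hB,
            evals_coercion_stack_iff]
          simp only [evals_stack_iff_checks hB (.inr ⟨e, he, .inr hi⟩)]
          constructor
          · rintro (⟨h₁, h₂⟩ | ⟨l, rfl, h⟩)
            · exact ⟨_, h₁, (evals_coercion_const_iff hc).2 h₂⟩
            · exact ⟨_, h, evals_cast_blame_iff.2 rfl⟩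
          · rintro ⟨Q, hQ, hR⟩
            rcases hQ.eq with rfl | ⟨l, rfl⟩
            · exact .inl ⟨hQ, (evals_coercion_const_iff hc).1 hR⟩
            · exact .inr ⟨l, evals_cast_blame_iff.1 hR, hQ⟩
  · exact (Step.castInnerE (fun _ _ _ _ _ => hne _ _ _ _ _) h).evals_iff

theorem Steps.evals_coercion_iff (hO : O.Lawful imp) (himp : ImplicationLaws O imp) {T₁ T₂ : Ty S}
    {c : Coercion S} {e e' R : Term S 0} (ht : Typed O imp .E false Fin.elim0 e T₁)
    (hc : WfCoercion O imp c T₁ T₂) (h : Steps O imp .E e e') :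
    Evals O imp (.cast T₁ (.coe c) T₂ none e) R ↔
      Evals O imp (.cast T₁ (.coe c) T₂ none e') R := by
  induction h with
  | refl => rfl
  | tail h h' ih => rw [ih, h'.evals_coercion_iff himp (ht.steps hO himp h) hc]

theorem Typed.arrow_val_cases {v : Term S 0} {T₁ T₂ : Ty S}
    (ht : Typed O imp .E false Fin.elim0 v (.arrow T₁ T₂)) (hv : Val .E v) :
    (∃ T e, v = .lam T e) ∨ ∃ T₁₁ T₁₂ T c₁ c₂ e,
      v = .cast (.arrow T₁₁ T₁₂) (.coe (.fn c₁ c₂)) (.arrow T₁ T₂) none (.lam T e) := by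
  cases hv with
  | const => obtain ⟨_, h, -⟩ := ht.const_inv; cases h
  | lam => exact .inl ⟨_, _, rfl⟩
  | proxyE => cases ht; exact .inr ⟨_, _, _, _, _, _, rfl⟩

/-- If the merge of two coercions has an outcome on a final term, then so does the first one. -/
theorem Final.exists_evals_of_merge (himp : ImplicationLaws O imp) {T₁ T₂ T₃ : Ty S}
    {c₁ c₂ c : Coercion S} {Q R : Term S 0} (hQ : Final Q)
    (ht : Typed O imp .E false Fin.elim0 Q T₁) (h₁ : WfCoercion O imp c₁ T₁ T₂)
    (h₂ : WfCoercion O imp c₂ T₂ T₃) (hc : c₁.merge imp c₂ = some c)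
    (hR : Evals O imp (.cast T₁ (.coe c) T₃ none Q) R) :
    ∃ R', Evals O imp (.cast T₁ (.coe c₁) T₂ none Q) R' := by
  obtain ⟨c', hc', hw⟩ := h₁.merge himp h₂
  rw [hc] at hc'
  cases hc'
  rcases hQ with hQ | ⟨l, rfl⟩
  · cases h₁ with
    | refs _ _ hB₁ _ _ hi₁ =>
      cases hQ with
      | const k =>
        obtain ⟨_, h, -⟩ := ht.const_inv
        cases h
        cases h₂ with
        | refs _ _ _ _ _ hi₂ =>
          rw [Coercion.merge, Option.some.injEq] at hc
          subst hc
          rw [evals_coercion_const_iff hw, RList.checks_merge_iff himp hB₁] at hR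
          obtain ⟨e, he, hi⟩ := hi₁
          simp only [Step.coerceStack.evals_iff,
            evals_stack_iff_checks hB₁ (.inr ⟨e, he, .inr hi⟩)]
          rcases hR with h | ⟨l, -, h⟩
          · exact ⟨_, h.1⟩
          · exact ⟨_, h⟩
      | lam => cases ht
      | proxyE => cases ht
    | fn h₁₁ h₁₂ =>
      rcases ht.arrow_val_cases hQ with ⟨T, e, rfl⟩ | ⟨_, _, _, _, _, _, rfl⟩
      · exact ⟨_, Final.evals_self (.inl (.proxyE _ _ _ _ _ _ _ _))⟩
      · cases ht with
        | coercion hc' ht =>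
          obtain ⟨d, hd, hwd⟩ := hc'.merge himp (.fn h₁₁ h₁₂)
          cases hwd with
          | fn => exact ⟨_, (Step.castMerge hd).evals_iff.2
              (Final.evals_self (.inl (.proxyE _ _ _ _ _ _ _ _)))⟩
  · exact ⟨_, evals_cast_blame_iff.2 rfl⟩

/-- To evaluate a coercion, one may evaluate its body first: eager merging is not observable. -/
theorem evals_coercion_iff (hO : O.Lawful imp) (himp : ImplicationLaws O imp) {T₁ T₂ : Ty S}
    {c : Coercion S} {e R : Term S 0} (ht : Typed O imp .E false Fin.elim0 e T₁)
    (hc : WfCoercion O imp c T₁ T₂) :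
    Evals O imp (.cast T₁ (.coe c) T₂ none e) R ↔
      ∃ Q, Evals O imp e Q ∧ Evals O imp (.cast T₁ (.coe c) T₂ none Q) R := by
  constructor
  · rintro ⟨hs, hR⟩
    generalize hX : Term.cast T₁ (.coe c) T₂ none e = X at hs
    induction hs using Relation.ReflTransGen.head_induction_on generalizing T₁ c e with
    | refl =>
      subst hX
      refine ⟨e, ?_, hR.evals_self⟩
      rcases hR with hR | ⟨l, hR⟩
      · cases hR with
        | proxyE => exact Final.evals_self (.inl (.lam _ _))
      · cases hR
    | head h hs ih =>
      subst hX
      have hX : Evals O imp _ R := ⟨.head h hs, hR⟩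
      cases h with
      | castInnerE hne h =>
        obtain ⟨Q, hQ, hQR⟩ := ih (ht.step hO himp h) hc rfl
        exact ⟨Q, h.evals_iff.2 hQ, hQR⟩
      | castMerge h =>
        cases ht with
        | coercion hc' ht =>
          obtain ⟨d, hd, hwd⟩ := hc'.merge himp hc
          rw [h] at hd
          cases hd
          -- The merged coercion acts on the outcome `Q₀` of the innermost body; then so does the
          -- inner coercion, which gives the outcome `Q` of the body.
          obtain ⟨Q₀, hQ₀, hQR₀⟩ := ih ht hwd rfl
          obtain ⟨Q, hQ⟩ := hQ₀.2.exists_evals_of_merge himp (ht.steps hO himp hQ₀.1) hc' hc h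
            hQR₀
          have hQ' := (Steps.evals_coercion_iff hO himp ht hc' hQ₀.1).2 hQ
          exact ⟨Q, hQ',
            (Steps.evals_coercion_iff hO himp (.coercion hc' ht) hc hQ'.1).1 hX⟩
      | castRaiseE => exact ⟨_, (Final.blame _).evals_self, hX⟩
      | coerceStack => exact ⟨_, (Final.const _).evals_self, hX⟩
  · rintro ⟨Q, hQ, hQR⟩
    exact (Steps.evals_coercion_iff hO himp ht hc hQ.1).2 hQR

/-! ### The logical relation -/

theorem ValRel.val : ∀ {T : Ty S} {v₁ v₂ : Term S 0}, ValRel O imp T v₁ v₂ →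
    Val .C v₁ ∧ Val .E v₂
  | .refine B e, _, _, h => by
    rw [ValRel] at h
    obtain ⟨k, rfl, rfl, -⟩ := h
    exact ⟨.const k, .const k⟩
  | .arrow T₁ T₂, _, _, h => by
    rw [ValRel] at h
    exact ⟨h.1, h.2.1⟩

theorem ValRel.typed : ∀ {T : Ty S} {v₁ v₂ : Term S 0}, ValRel O imp T v₁ v₂ →
    WfTy O imp .E false T → Typed O imp .E false Fin.elim0 v₂ T
  | .refine B e, _, _, h, hT => by
    rw [ValRel] at h
    obtain ⟨k, rfl, rfl, hk, he⟩ := h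
    exact .const (fun i => i.elim0) hk hT he (fun h => nomatch h)
  | .arrow T₁ T₂, _, _, h, _ => by
    rw [ValRel] at h
    exact h.2.2.1

/-- The term relation, with its eidetic side in terms of evaluation. -/
theorem termRel_iff {T : Ty S} {e₁ e₂ : Term S 0} : TermRel O imp T e₁ e₂ ↔
    (∃ l, Steps O imp .C e₁ (.blame l) ∧ Evals O imp e₂ (.blame l)) ∨
    ∃ v₁ v₂, Steps O imp .C e₁ v₁ ∧ Evals O imp e₂ v₂ ∧ ValRel O imp T v₁ v₂ := by
  constructor
  · rintro (⟨l, h₁, h₂⟩ | ⟨v₁, v₂, h₁, -, h₂, hv₂, h⟩)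
    · exact .inl ⟨l, h₁, h₂, .blame l⟩
    · exact .inr ⟨v₁, v₂, h₁, ⟨h₂, .inl hv₂⟩, h⟩
  · rintro (⟨l, h₁, h₂⟩ | ⟨v₁, v₂, h₁, h₂, h⟩)
    · exact .inl ⟨l, h₁, h₂.1⟩
    · exact .inr ⟨v₁, v₂, h₁, h.val.1, h₂.1, h.val.2, h⟩

theorem ValRel.termRel {T : Ty S} {v₁ v₂ : Term S 0} (h : ValRel O imp T v₁ v₂) :
    TermRel O imp T v₁ v₂ :=
  .inr ⟨v₁, v₂, .refl, h.val.1, .refl, h.val.2, h⟩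

theorem TermRel.blame {T : Ty S} (l : Label S) : TermRel O imp T (.blame l) (.blame l) :=
  .inl ⟨l, .refl, .refl⟩

/-- The term relation is closed under classic expansion and under changing the eidetic term to one
with the same outcomes. -/
theorem TermRel.congr {T : Ty S} {e₁ e₁' e₂ e₂' : Term S 0} (h : TermRel O imp T e₁' e₂')
    (h₁ : Steps O imp .C e₁ e₁') (h₂ : ∀ R, Evals O imp e₂ R ↔ Evals O imp e₂' R) :
    TermRel O imp T e₁ e₂ := by
  simp only [termRel_iff, h₂] at h ⊢
  rcases h with ⟨l, h, h'⟩ | ⟨v₁, v₂, h, h', hv⟩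
  · exact .inl ⟨l, h₁.trans h, h'⟩
  · exact .inr ⟨v₁, v₂, h₁.trans h, h', hv⟩

theorem TermRel.expand {T : Ty S} {e₁ e₁' e₂ e₂' : Term S 0} (h : TermRel O imp T e₁' e₂')
    (h₁ : Steps O imp .C e₁ e₁') (h₂ : Steps O imp .E e₂ e₂') : TermRel O imp T e₁ e₂ :=
  h.congr h₁ fun _ => h₂.evals_iff

theorem TermRel.app_val {T₁ T₂ : Ty S} {v₁ v₂ e₁ e₂ : Term S 0}
    (hv : ValRel O imp (.arrow T₁ T₂) v₁ v₂) (he : TermRel O imp T₁ e₁ e₂) :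
    TermRel O imp T₂ (.app v₁ e₁) (.app v₂ e₂) := by
  have hval := hv.val
  rcases he with ⟨l, h₁, h₂⟩ | ⟨u₁, u₂, h₁, -, h₂, -, hu⟩
  · exact (TermRel.blame l).expand
      ((Steps.map (.appR hval.1) h₁).tail (.appRaiseR hval.1))
      ((Steps.map (.appR hval.2) h₂).tail (.appRaiseR hval.2))
  · rw [ValRel] at hv
    exact TermRel.expand (hv.2.2.2 u₁ u₂ hu) (Steps.map (.appR hval.1) h₁)
      (Steps.map (.appR hval.2) h₂)

theorem TermRel.app {T₁ T₂ : Ty S} {f₁ f₂ e₁ e₂ : Term S 0}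
    (hf : TermRel O imp (.arrow T₁ T₂) f₁ f₂) (he : TermRel O imp T₁ e₁ e₂) :
    TermRel O imp T₂ (.app f₁ e₁) (.app f₂ e₂) := by
  rcases hf with ⟨l, h₁, h₂⟩ | ⟨v₁, v₂, h₁, -, h₂, -, hv⟩
  · exact (TermRel.blame l).expand
      ((Steps.map (F := fun e => .app e e₁) .appL h₁).tail .appRaiseL)
      ((Steps.map (F := fun e => .app e e₂) .appL h₂).tail .appRaiseL)
  · exact (TermRel.app_val hv he).expand (Steps.map (F := fun e => .app e e₁) .appL h₁)
      (Steps.map (F := fun e => .app e e₂) .appL h₂)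

/-! ### Operations -/

theorem Steps.op_update {m : Mode} {o : S.Op} {es : Fin (S.arity o) → Term S 0}
    {i : Fin (S.arity o)} (hv : ∀ j, j < i → Val m (es j)) {e : Term S 0}
    (h : Steps O imp m (es i) e) :
    Steps O imp m (.op o es) (.op o (Function.update es i e)) := by
  induction h with
  | refl => rw [Function.update_eq_self]; exact .refl
  | @tail e e' _ h ih =>
    have hst : Step O imp m (.op o (Function.update es i e))
        (.op o (Function.update (Function.update es i e) i e')) :=
      .opInner i (fun j hj => by simpa [hj.ne] using hv j hj) (by simpa using h)
    rw [Function.update_idem] at hst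
    exact ih.tail hst

/-- Evaluating the first `n` arguments of an operation to constants. -/
theorem Steps.op_prefix {m : Mode} {o : S.Op} {es : Fin (S.arity o) → Term S 0}
    {ks : Fin (S.arity o) → S.Const} : ∀ n : ℕ, n ≤ S.arity o →
    (∀ i : Fin (S.arity o), i.val < n → Steps O imp m (es i) (.const (ks i))) →
    Steps O imp m (.op o es) (.op o fun i => if i.val < n then .const (ks i) else es i)
  | 0, _, _ => by simpa using .refl
  | n + 1, hn, h => by
    refine (Steps.op_prefix n (by omega) fun i hi => h i (by omega)).trans ?_
    have hst := Steps.op_update (O := O) (imp := imp) (m := m) (o := o) (i := ⟨n, hn⟩)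
      (es := fun i => if i.val < n then .const (ks i) else es i) (e := .const (ks ⟨n, hn⟩))
      (fun j hj => by
        have : j.val < n := hj
        simpa [this] using .const _)
      (by simpa using h ⟨n, hn⟩ (by simp))
    have heq : (fun i : Fin (S.arity o) => if i.val < n + 1 then Term.const (ks i) else es i) =
        Function.update (fun i => if i.val < n then .const (ks i) else es i) ⟨n, hn⟩
          (.const (ks ⟨n, hn⟩)) := by
      funext i
      by_cases hi : i = ⟨n, hn⟩
      · subst hi; simp
      · have hne : i.val ≠ n := fun h => hi (Fin.ext h)
        have : i.val < n + 1 ↔ i.val < n := by omega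
        simp [hi, this]
    rw [heq]
    exact hst

theorem Steps.op_blame {m : Mode} {o : S.Op} {es : Fin (S.arity o) → Term S 0}
    {ks : Fin (S.arity o) → S.Const} {i : Fin (S.arity o)} {l : Label S}
    (h : ∀ j, j < i → Steps O imp m (es j) (.const (ks j)))
    (hi : Steps O imp m (es i) (.blame l)) : Steps O imp m (.op o es) (.blame l) := by
  have hv : ∀ j, j < i →
      Val m (if j.val < i.val then Term.const (ks j) else es j : Term S 0) := fun j hj => by
    have : j.val < i.val := hj
    simpa [this] using .const _
  refine (Steps.op_prefix i.val i.isLt.le h).trans ?_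
  refine (Steps.op_update (i := i) (e := .blame l) hv (by simpa using hi)).tail ?_
  exact .opRaise i (fun j hj => by simpa [hj.ne] using hv j hj) (by simp)

theorem TermRel.op (hO : O.Lawful imp) {o : S.Op} {es₁ es₂ : Fin (S.arity o) → Term S 0}
    (h : ∀ i, TermRel O imp (.refine (O.argBase o i) (O.argPred o i)) (es₁ i) (es₂ i)) :
    TermRel O imp (.refine (O.resBase o) (O.resPred o)) (.op o es₁) (.op o es₂) := by
  let P (i : Fin (S.arity o)) (k : S.Const) : Prop := Steps O imp .C (es₁ i) (.const k) ∧
    Steps O imp .E (es₂ i) (.const k) ∧ S.tyConst k = O.argBase o i ∧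
    Steps O imp .E ((O.argPred o i).inst (.const k)) (.const S.tt)
  have hP : ∀ i, (∃ k, P i k) ∨
      ∃ l, Steps O imp .C (es₁ i) (.blame l) ∧ Steps O imp .E (es₂ i) (.blame l) := fun i => by
    rcases h i with ⟨l, h₁, h₂⟩ | ⟨v₁, v₂, h₁, -, h₂, -, hv⟩
    · exact .inr ⟨l, h₁, h₂⟩
    · rw [ValRel] at hv
      obtain ⟨k, rfl, rfl, hk, he⟩ := hv
      exact .inl ⟨k, h₁, h₂, hk, he⟩
  have hks : ∀ i, ∃ k, (∃ k, P i k) → P i k := fun i => by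
    by_cases hi : ∃ k, P i k
    · exact ⟨hi.choose, fun _ => hi.choose_spec⟩
    · exact ⟨S.tt, fun h => absurd h hi⟩
  choose ks hks using hks
  by_cases hall : ∀ i, ∃ k, P i k
  · have hks' := fun i => hks i (hall i)
    obtain ⟨k, hk⟩ := (hO.defined_iff .E o ks fun i => (hks' i).2.2.1).2
      fun i => (hks' i).2.2.2
    obtain ⟨hk₁, hk₂⟩ := hO.res_ok .E o ks k (fun i => (hks' i).2.2.1) hk
    have hv : ValRel O imp (.refine (O.resBase o) (O.resPred o)) (.const k) (.const k) := by
      rw [ValRel]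
      exact ⟨k, rfl, rfl, hk₁, hk₂⟩
    have key : ∀ {m : Mode} {es : Fin (S.arity o) → Term S 0},
        (∀ i, Steps O imp m (es i) (.const (ks i))) → Steps O imp m (.op o es) (.const k) := by
      intro m es hes
      have := Steps.op_prefix (S.arity o) le_rfl fun i _ => hes i
      simp only [Fin.is_lt, if_true] at this
      exact this.tail (.op hk)
    exact hv.termRel.expand (key fun i => (hks' i).1) (key fun i => (hks' i).2.1)
  · -- The first argument without a value raises blame in both semantics.
    push Not at hall
    obtain ⟨i, hi, hmin⟩ := WellFounded.has_min (wellFounded_lt (α := Fin (S.arity o)))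
      {i | ∀ k, ¬P i k} hall
    have hlt : ∀ j, j < i → P j (ks j) := fun j hj => hks j <| by
      by_contra hn
      exact hmin j (not_exists.1 hn) hj
    rcases hP i with ⟨k, hk⟩ | ⟨l, h₁, h₂⟩
    · exact absurd hk (hi k)
    · exact (TermRel.blame l).expand (Steps.op_blame (fun j hj => (hlt j hj).1) h₁)
        (Steps.op_blame (fun j hj => (hlt j hj).2.1) h₂)

/-! ### Casts -/

/-- Eidetically, a cast function is a proxy that behaves like an unmerged proxy around the original
function. -/
theorem exists_proxy (hO : O.Lawful imp) (himp : ImplicationLaws O imp)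
    {T₁₁ T₁₂ T₂₁ T₂₂ : Ty S} {c₁ c₂ : Coercion S} {v : Term S 0}
    (hc₁ : WfCoercion O imp c₁ T₂₁ T₁₁) (hc₂ : WfCoercion O imp c₂ T₁₂ T₂₂) (hv : Val .E v)
    (ht : Typed O imp .E false Fin.elim0 v (.arrow T₁₁ T₁₂)) :
    ∃ w, Val .E w ∧
      Steps O imp .E (.cast (.arrow T₁₁ T₁₂) (.coe (.fn c₁ c₂)) (.arrow T₂₁ T₂₂) none v) w ∧
      ∀ u, Val .E u → Typed O imp .E false Fin.elim0 u T₂₁ → ∀ R, Evals O imp (.app w u) R ↔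
        Evals O imp (.cast T₁₂ (.coe c₂) T₂₂ none
          (.app v (.cast T₂₁ (.coe c₁) T₁₁ none u))) R := by
  rcases ht.arrow_val_cases hv with ⟨T, e, rfl⟩ | ⟨A₁, A₂, T, d₁, d₂, e, rfl⟩
  · have hw := Val.proxyE T₁₁ T₁₂ T₂₁ T₂₂ T c₁ c₂ e
    exact ⟨_, hw, .refl, fun u hu _ R => (Step.unwrap hw hu rfl rfl).evals_iff⟩
  · cases ht with
    | coercion hd hte =>
      cases hd with
      | fn hd₁ hd₂ =>
        obtain ⟨m₁, hm₁, hwm₁⟩ := hc₁.merge himp hd₁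
        obtain ⟨m₂, hm₂, hwm₂⟩ := hd₂.merge himp hc₂
        have hw := Val.proxyE A₁ A₂ T₂₁ T₂₂ T m₁ m₂ e
        refine ⟨_, hw, .single (.castMerge
          (Coercion.merge_fn_eq_some.2 ⟨m₁, m₂, hm₁, hm₂, rfl⟩)), fun u hu htu R => ?_⟩
        have htv := Typed.coercion (.fn hd₁ hd₂) hte
        -- The coercion `m₁` on the argument is the merge of `c₁` and `d₁`, so its outcomes are those
        -- of `d₁` on the outcomes `W` of `c₁`, on which the proxy `v` acts.
        have hinner : ∀ Q, Evals O imp (.cast A₂ (.coe d₂) T₁₂ none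
              (.app (.lam T e) (.cast T₂₁ (.coe m₁) A₁ none u))) Q ↔
            Evals O imp (.app (.cast (.arrow A₁ A₂) (.coe (.fn d₁ d₂)) (.arrow T₁₁ T₁₂) none
              (.lam T e)) (.cast T₂₁ (.coe c₁) T₁₁ none u)) Q := fun Q => by
          have hfinal : ∀ W, Evals O imp (.cast T₂₁ (.coe c₁) T₁₁ none u) W →
              (Evals O imp (.app (.cast (.arrow A₁ A₂) (.coe (.fn d₁ d₂)) (.arrow T₁₁ T₁₂) none
                (.lam T e)) W) Q ↔
              Evals O imp (.cast A₂ (.coe d₂) T₁₂ none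
                (.app (.lam T e) (.cast T₁₁ (.coe d₁) A₁ none W))) Q) := by
            rintro W ⟨hs, hW | ⟨l, rfl⟩⟩
            · exact (Step.unwrap hv hW rfl rfl).evals_iff
            · have ht' : Typed O imp .E false Fin.elim0 (.blame l) T₁₁ :=
                .blame (fun i => i.elim0) hd₁.wf.1
              have happ : ∀ Z, Evals O imp
                  (.app (.lam T e) (.cast T₁₁ (.coe d₁) A₁ none (.blame l))) Z ↔ Z = .blame l := by
                intro Z
                rw [evals_app_iff (Val.lam T e)]
                simp only [evals_cast_blame_iff, exists_eq_left, evals_app_blame_iff (Val.lam T e)]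
              rw [evals_app_blame_iff hv,
                evals_coercion_iff hO himp (.app hte (.coercion hd₁ ht')) hd₂]
              simp only [happ, evals_cast_blame_iff, exists_eq_left]
          have htW : ∀ W, Evals O imp (.cast T₂₁ (.coe c₁) T₁₁ none u) W →
              Typed O imp .E false Fin.elim0 W T₁₁ := fun W hW =>
            (Typed.coercion hc₁ htu).steps hO himp hW.1
          have hmerge : ∀ Y, Evals O imp (.cast T₂₁ (.coe m₁) A₁ none u) Y ↔
              ∃ W, Evals O imp (.cast T₂₁ (.coe c₁) T₁₁ none u) W ∧
                Evals O imp (.cast T₁₁ (.coe d₁) A₁ none W) Y := fun Y => by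
            rw [← (Step.castMerge hm₁ (l' := none)).evals_iff,
              evals_coercion_iff hO himp (.coercion hc₁ htu) hd₁]
          rw [evals_coercion_iff hO himp (.app hte (.coercion hwm₁ htu)) hd₂, evals_app_iff hv]
          constructor
          · rintro ⟨Z, hZ, hQ⟩
            obtain ⟨Y, hY, hZ⟩ := (evals_app_iff (Val.lam T e)).1 hZ
            obtain ⟨W, hW, hY⟩ := (hmerge Y).1 hY
            refine ⟨W, hW, (hfinal W hW).2 ?_⟩
            rw [evals_coercion_iff hO himp (.app hte (.coercion hd₁ (htW W hW))) hd₂]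
            exact ⟨Z, (evals_app_iff (Val.lam T e)).2 ⟨Y, hY, hZ⟩, hQ⟩
          · rintro ⟨W, hW, hQ⟩
            rw [hfinal W hW,
              evals_coercion_iff hO himp (.app hte (.coercion hd₁ (htW W hW))) hd₂] at hQ
            obtain ⟨Z, hZ, hQ⟩ := hQ
            obtain ⟨Y, hY, hZ⟩ := (evals_app_iff (Val.lam T e)).1 hZ
            exact ⟨Z, (evals_app_iff (Val.lam T e)).2 ⟨Y, (hmerge Y).2 ⟨W, hW, hY⟩, hZ⟩, hQ⟩
        rw [(Step.unwrap hw hu rfl rfl).evals_iff,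
          ← (Step.castMerge hm₂ (l' := none)).evals_iff,
          evals_coercion_iff hO himp (.coercion hd₂ (.app hte (.coercion hwm₁ htu))) hc₂,
          evals_coercion_iff hO himp (.app htv (.coercion hc₁ htu)) hc₂]
        simp only [hinner]

/-- The classic cast from `T₁` to `T₂` with label `l` and the coercion it is translated to take
related values to related terms. -/
def CastRel (O : OpInterp S) (imp : Implication S) (l : Label S) (T₁ T₂ : Ty S) : Prop :=
  ∃ c, coerce l T₁ T₂ = some c ∧ WfCoercion O imp c T₁ T₂ ∧
    ∀ v₁ v₂, ValRel O imp T₁ v₁ v₂ →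
      TermRel O imp T₂ (.cast T₁ .none T₂ l v₁) (.cast T₁ (.coe c) T₂ none v₂)

/-- A cast whose coercion relates values relates terms: the classic cast evaluates its body first,
and the eidetic coercion may be thought of as doing so. -/
theorem TermRel.coercion (hO : O.Lawful imp) (himp : ImplicationLaws O imp) {l : Label S}
    {T₁ T₂ : Ty S} {c : Coercion S} (hc : WfCoercion O imp c T₁ T₂)
    (hcast : ∀ v₁ v₂, ValRel O imp T₁ v₁ v₂ →
      TermRel O imp T₂ (.cast T₁ .none T₂ l v₁) (.cast T₁ (.coe c) T₂ none v₂))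
    {e₁ e₂ : Term S 0} (ht : Typed O imp .E false Fin.elim0 e₂ T₁)
    (h : TermRel O imp T₁ e₁ e₂) :
    TermRel O imp T₂ (.cast T₁ .none T₂ l e₁) (.cast T₁ (.coe c) T₂ none e₂) := by
  rcases h with ⟨l', h₁, h₂⟩ | ⟨v₁, v₂, h₁, -, h₂, -, hv⟩
  · refine (TermRel.blame l').congr ((Steps.map .castInnerC h₁).tail .castRaiseC) fun R => ?_
    rw [Steps.evals_coercion_iff hO himp ht hc h₂, evals_cast_blame_iff, evals_blame_iff]
  · exact (hcast v₁ v₂ hv).congr (Steps.map .castInnerC h₁) fun R =>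
      Steps.evals_coercion_iff hO himp ht hc h₂

/-- Both sides check the target predicate, the eidetic one on a stack with this single check. -/
theorem CastRel.refine (himp : ImplicationLaws O imp) {l : Label S} {B : S.Base}
    {e₁ e₂ : Term S 1} (h₁ : WfTy O imp .E false (.refine B e₁))
    (h₂ : WfTy O imp .E false (.refine B e₂))
    (hr : TyRel O imp (.refine B e₂) (.refine B e₂)) :
    CastRel O imp l (.refine B e₁) (.refine B e₂) := by
  obtain ⟨c, hc, hw⟩ := WfCoercion.coerce himp l (.refine B e₁ e₂) h₁ h₂
  refine ⟨c, hc, hw, fun v₁ v₂ hv => ?_⟩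
  rw [coerce_refine, Option.some.injEq] at hc
  subst hc
  rw [ValRel] at hv
  obtain ⟨k, rfl, rfl, hk, -⟩ := hv
  have hraw : ValRel O imp (Ty.raw B) (.const k) (.const k) := by
    rw [Ty.raw, ValRel]
    exact ⟨k, rfl, rfl, hk, .refl⟩
  rw [TyRel] at hr
  have hinner := hr.2 _ _ hraw
  have hC : ∀ {e}, Steps O imp .C (e₂.inst (.const k)) e →
      Steps O imp .C (.cast (.refine B e₁) .none (.refine B e₂) l (.const k))
        (.check B e₂ e k l) := fun h =>
    .head .checkNone (Steps.map (F := fun e => .check B e₂ e k l) .checkInner h)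
  rw [termRel_iff]
  simp only [evals_coercion_const_iff hw, RList.Checks]
  rcases hinner with ⟨l', h, h'⟩ | ⟨v₁, v₂, h, -, h', -, hv⟩
  · exact .inl ⟨l', (hC h).tail .checkRaise, .inr ⟨l', evals_check_iff.2
      ⟨_, ⟨h', .blame l'⟩, Step.checkRaise.evals_iff.2 (Final.blame l').evals_self⟩, rfl⟩⟩
  · rw [Ty.raw, ValRel] at hv
    obtain ⟨b, rfl, rfl, hb, -⟩ := hv
    rcases (S.tyConst_bool_iff b).1 hb with rfl | rfl
    · refine .inr ⟨.const k, .const k, (hC h).tail .checkOK, .inl ⟨h', rfl⟩, ?_⟩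
      rw [ValRel]
      exact ⟨k, rfl, rfl, hk, h'⟩
    · exact .inl ⟨l, (hC h).tail .checkFail, .inr ⟨l, evals_check_iff.2
        ⟨_, ⟨h', .const _⟩, Step.checkFail.evals_iff.2 (Final.blame l).evals_self⟩, rfl⟩⟩

/-- Applying the two proxies to related arguments casts the arguments, applies the original
functions, which are related, and casts the results. -/
theorem CastRel.arrow (hO : O.Lawful imp) (himp : ImplicationLaws O imp) {l : Label S}
    {T₁₁ T₁₂ T₂₁ T₂₂ : Ty S} (h₁ : CastRel O imp l T₂₁ T₁₁) (h₂ : CastRel O imp l T₁₂ T₂₂) :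
    CastRel O imp l (.arrow T₁₁ T₁₂) (.arrow T₂₁ T₂₂) := by
  obtain ⟨c₁, hc₁, hw₁, h₁⟩ := h₁
  obtain ⟨c₂, hc₂, hw₂, h₂⟩ := h₂
  refine ⟨_, coerce_arrow hc₁ hc₂, .fn hw₁ hw₂, fun v₁ v₂ hv => ?_⟩
  have ht := hv.typed (.arrow hw₁.wf.2 hw₂.wf.1)
  obtain ⟨w, hw, hs, hwu⟩ := exists_proxy hO himp hw₁ hw₂ hv.val.2 ht
  refine TermRel.expand (ValRel.termRel ?_) .refl hs
  have hvC : Val .C (.cast (.arrow T₁₁ T₁₂) .none (.arrow T₂₁ T₂₂) l v₁) := .proxyC hv.val.1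
  rw [ValRel]
  refine ⟨hvC, hw, (Typed.coercion (.fn hw₁ hw₂) ht).steps hO himp hs, fun u₁ u₂ hu => ?_⟩
  have htu := hu.typed hw₁.wf.1
  refine TermRel.congr ?_ (.single (.unwrap hvC hu.val.1 rfl rfl)) (hwu u₂ hu.val.2 htu)
  exact TermRel.coercion hO himp hw₂ h₂ (.app ht (.coercion hw₁ htu))
    (TermRel.app_val hv (h₁ u₁ u₂ hu))

/-- Both directions are proved together, as domains are cast contravariantly. -/
theorem castRel_of_compat (hO : O.Lawful imp) (himp : ImplicationLaws O imp) (l : Label S)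
    {T₁ T₂ : Ty S} (hc : Compat T₁ T₂) (h₁ : WfTy O imp .E false T₁)
    (h₂ : WfTy O imp .E false T₂) (hr₁ : TyRel O imp T₁ T₁) (hr₂ : TyRel O imp T₂ T₂) :
    CastRel O imp l T₁ T₂ ∧ CastRel O imp l T₂ T₁ := by
  induction hc with
  | refine B e₁ e₂ => exact ⟨.refine himp h₁ h₂ hr₂, .refine himp h₂ h₁ hr₁⟩
  | arrow _ _ ih₁ ih₂ =>
    rw [TyRel] at hr₁ hr₂
    have i₁ := ih₁ h₁.arrow_inv.1 h₂.arrow_inv.1 hr₁.1 hr₂.1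
    have i₂ := ih₂ h₁.arrow_inv.2 h₂.arrow_inv.2 hr₁.2 hr₂.2
    exact ⟨.arrow hO himp i₁.2 i₂.1, .arrow hO himp i₁.1 i₂.2⟩

/-! ### The fundamental property -/

theorem SubstRel.typed {n : ℕ} {Γ : Fin n → Ty S} {δ₁ δ₂ : Fin n → Term S 0}
    (hδ : SubstRel O imp Γ δ₁ δ₂) (hΓ : ∀ i, WfTy O imp .E false (Γ i)) {e : Term S n}
    {T : Ty S} (h : Typed O imp .E false Γ e T) :
    Typed O imp .E false Fin.elim0 (e.subst δ₂) T :=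
  h.subst _ (fun i => i.elim0) fun i => (hδ i).typed (hΓ i)

mutual

/-- The fundamental property of the logical relation for types; the mode `m` is arbitrary because
source judgments do not depend on it. -/
theorem WfTy.tyRel (hO : O.Lawful imp) (himp : ImplicationLaws O imp) {m : Mode} {src : Bool}
    {T : Ty S} (h : WfTy O imp m src T) (hs : src = true) : TyRel O imp T T := by
  match h with
  | .base B =>
    rw [Ty.raw, TyRel]
    refine ⟨rfl, fun v₁ v₂ _ => ValRel.termRel (v₁ := .const S.tt) (v₂ := .const S.tt) ?_⟩
    rw [Ty.raw, ValRel]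
    exact ⟨S.tt, rfl, rfl, (S.tyConst_bool_iff _).2 (.inl rfl), .refl⟩
  | .refine h =>
    rw [TyRel]
    exact ⟨rfl, fun v₁ v₂ hv => h.openRel hO himp hs _ _ fun _ => hv⟩
  | .arrow h₁ h₂ =>
    rw [TyRel]
    exact ⟨h₁.tyRel hO himp hs, h₂.tyRel hO himp hs⟩

/-- The fundamental property of the logical relation for terms. -/
theorem Typed.openRel (hO : O.Lawful imp) (himp : ImplicationLaws O imp) {m : Mode} {src : Bool}
    {n : ℕ} {Γ : Fin n → Ty S} {e : Term S n} {T : Ty S} (h : Typed O imp m src Γ e T)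
    (hs : src = true) : OpenRel O imp Γ e e T := by
  intro δ₁ δ₂ hδ
  have hΓ : ∀ i, WfTy O imp .E false (Γ i) := fun i => (h.wf_ctx i).eidetic hs
  match h, hs with
  | .var _ i, hs => exact (hδ i).termRel
  | .const (k := k) _ hk _ _ hsrc, hs =>
    refine ValRel.termRel (v₁ := .const k) (v₂ := .const k) ?_
    rw [hsrc hs, ValRel]
    exact ⟨k, rfl, rfl, hk, .refl⟩
  | .lam hT he, hs =>
    refine ValRel.termRel (v₁ := .lam _ _) (v₂ := .lam _ _) ?_
    rw [ValRel]
    refine ⟨.lam _ _, .lam _ _, hδ.typed hΓ ((Typed.lam hT he).eidetic hs), fun u₁ u₂ hu => ?_⟩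
    have hδ' := he.openRel hO himp hs (Fin.cons u₁ δ₁) (Fin.cons u₂ δ₂) fun i => by
      refine Fin.cases ?_ (fun j => ?_) i
      · exact hu
      · exact hδ j
    refine TermRel.expand hδ' (.single ?_) (.single ?_)
    · rw [← Term.inst_subst_lift]; exact .beta hu.val.1
    · rw [← Term.inst_subst_lift]; exact .beta hu.val.2
  | .app h₁ h₂, hs =>
    exact TermRel.app (h₁.openRel hO himp hs δ₁ δ₂ hδ) (h₂.openRel hO himp hs δ₁ δ₂ hδ)
  | .op _ h, hs => exact TermRel.op hO fun i => (h i).openRel hO himp hs δ₁ δ₂ hδ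
  | .cast (l := l) h₁ h₂ hc he _, hs =>
    obtain ⟨⟨c, hco, hw, hcast⟩, -⟩ := castRel_of_compat hO himp l hc (h₁.eidetic hs)
      (h₂.eidetic hs) (h₁.tyRel hO himp hs) (h₂.tyRel hO himp hs)
    exact (TermRel.coercion hO himp hw hcast (hδ.typed hΓ (he.eidetic hs))
      (he.openRel hO himp hs δ₁ δ₂ hδ)).expand .refl (.single (.coerce hco))

end

end LambdaH

theorem mainTheorem1 (S : Signature.{u}) (O : OpInterp S) (imp : Implication S)
    (hO : O.Lawful imp) (himp : ImplicationLaws O imp) :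
    (∀ (n : ℕ) (Γ : Fin n → Ty S) (e : Term S n) (T : Ty S),
      Typed O imp Mode.C true Γ e T → OpenRel O imp Γ e e T) ∧
    (∀ T : Ty S, WfTy O imp Mode.C true T → TyRel O imp T T) ∧
    (∀ (e : Term S 0) (T : Ty S), Typed O imp Mode.C true Fin.elim0 e T →
      (∃ l : Label S, Steps O imp Mode.C e (Term.blame l) ∧ Steps O imp Mode.E e (Term.blame l)) ∨
      ∃ v₁ v₂ : Term S 0, Steps O imp Mode.C e v₁ ∧ Val Mode.C v₁ ∧
        Steps O imp Mode.E e v₂ ∧ Val Mode.E v₂ ∧ ValRel O imp T v₁ v₂) := by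
  refine ⟨fun n Γ e T h => h.openRel hO himp rfl, fun T h => h.tyRel hO himp rfl,
    fun e T h => ?_⟩
  have hrel := h.openRel hO himp rfl Fin.elim0 Fin.elim0 fun i => i.elim0
  rwa [Term.subst_closed] at hrel
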